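/- \textbf{Setting.} Fix an integer $r\ge 1$ and constants $\bar c_1,\bar c_2,K<\infty$. For each sample size $n$ let $m=m_n$ and $M=M_n$ be integers with $r\le M\le m$ and $\frac{M\log n}{n}\to 0$, let $s=s_n$ and $\sigma=\sigma_n>0$ be (known) reals with $s\ge\sigma^2>0$, let $\Phi=\Phi_n$ be a known $M\times m$ matrix with $\Phi\Phi^T=I_M$, and let $Y_1,\dots,Y_n$ be i.i.d. $N_m(0,\overline\Sigma_0+\sigma^2 I_m)$, where $\overline\Sigma_0=\overline\Sigma_{0,n}$ is a symmetric positive semidefinite $m\times m$ matrix. Let $\|\cdot\|_F$ be the Frobenius norm, and let $\Omega=\{B\in\mathbb R^{M\times r}:B^TB=I_r\}\times(0,\infty)^r$, where $\Lambda\in(0,\infty)^r$ is identified with the diagonal matrix with diagonal $\Lambda$. For $(B,\Lambda)\in\Omega$ put $\Gamma=sB\Lambda B^T+\sigma^2I_M$, $\widetilde Y_i=\Phi Y_i$, and $$\widetilde L_n(B,\Lambda)=\frac1{2n}\operatorname{tr}\Big(\Gamma^{-1}\sum_{i=1}^n\widetilde Y_i\widetilde Y_i^T\Big)+\frac12\log|\Gamma|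 .$$ \textbf{A1$'$.} The eigenvalues $s\bar\lambda_1\ge\dots\ge s\bar\lambda_m\ge 0$ of $\overline\Sigma_0$ (with $\bar\lambda_{m+1}:=0$) satisfy $\bar c_1\ge\bar\lambda_1>\dots>\bar\lambda_r>\bar\lambda_{r+1}$ and $\max_{1\le j\le r}(\bar\lambda_j-\bar\lambda_{j+1})^{-1}\le\bar c_2$. \textbf{C$''$.} $(B_*,\Lambda_*)=(B_{*,n},\Lambda_{*,n})\in\Omega$ satisfies $\|\overline\Sigma_0-s\,\Phi^TB_*\Lambda_*B_*^T\Phi\|_F\le K\sigma^2\sqrt{\frac{M\log n}{n}}$ for all large $n$. \textbf{Theorem 3 (matrix case).} For every $\eta>0$ there are $c_{0,\eta},C_\eta>0$, depending only on $\eta,r,\bar c_1,\bar c_2,K$, such that the following holds for all such sequences satisfying A1$'$ and C$''$. Put $\alpha_n=c_{0,\eta}\,\sigma\sqrt{\frac{M\log n}{ns}}$. Then for all sufficiently large $n$, with probability at least $1-C_\eta n^{-\eta}$, there is a minimizer $(\widehat B,\widehat\Lambda)$ of $\widetilde L_n$ over $\Omega$ satisfying $$\|(I_M-B_*B_*^T)(\widehat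 B-B_*)\|_F\le\alpha_n,\qquad \|B_*^T(\widehat B-B_*)\|_F\le\sqrt{\tfrac{s}{\sigma^2}}\,\alpha_n,\qquad \|\widehat\Lambda-\Lambda_*\|_F\le\sqrt{\tfrac{s}{\sigma^2}}\,\alpha_n .$$ -/

import Mathlib

open MeasureTheory ProbabilityTheory Filter Topology
open scoped Matrix Matrix.Norms.Frobenius

namespace RemlMatrix

/-- The `j`-th largest eigenvalue (`j = 0, 1, …`, with multiplicity) of a real symmetric `m × m`
matrix, with the convention that it is `0` for `j ≥ m`. -/
noncomputable def sortedEigenvalue {m : ℕ} {A : Matrix (Fin m) (Fin m) ℝ} (hA : A.IsHermitian)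
    (j : ℕ) : ℝ :=
  if h : j < m then hA.eigenvalues₀ ⟨j, by simpa using h⟩ else 0

/-- The eigenvalue condition on `Σ̄₀`: writing its eigenvalues as `s λ̄₁ ≥ s λ̄₂ ≥ ⋯ ≥ 0`
(`λ̄_{j+1}` is `sortedEigenvalue hA j / s`), we have `c₁ ≥ λ̄₁ > ⋯ > λ̄_r > λ̄_{r+1}` and
`(λ̄_j - λ̄_{j+1})⁻¹ ≤ c₂` for `1 ≤ j ≤ r`. -/
structure EigenvalueCondition {m : ℕ} (A : Matrix (Fin m) (Fin m) ℝ) (s : ℝ) (r : ℕ)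
    (c₁ c₂ : ℝ) : Prop where
  posSemidef : A.PosSemidef
  le_bound : sortedEigenvalue posSemidef.isHermitian 0 / s ≤ c₁
  strictly_decreasing : ∀ j < r,
    sortedEigenvalue posSemidef.isHermitian (j + 1) / s <
      sortedEigenvalue posSemidef.isHermitian j / s
  gap : ∀ j < r,
    (sortedEigenvalue posSemidef.isHermitian j / s -
      sortedEigenvalue posSemidef.isHermitian (j + 1) / s)⁻¹ ≤ c₂

/-- The parameter space: pairs `(B, Λ)` with `B` an `M × r` matrix with orthonormal columns and
`Λ` a vector of `r` positive numbers (the diagonal of a diagonal matrix). -/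
def paramSpace (M r : ℕ) : Set (Matrix (Fin M) (Fin r) ℝ × (Fin r → ℝ)) :=
  {p | p.1ᵀ * p.1 = 1 ∧ ∀ k, 0 < p.2 k}

/-- The matrix `Γ = s B Λ Bᵀ + σ² I_M`. -/
noncomputable def modelCov {M r : ℕ} (s σ : ℝ) (p : Matrix (Fin M) (Fin r) ℝ × (Fin r → ℝ)) :
    Matrix (Fin M) (Fin M) ℝ :=
  s • (p.1 * Matrix.diagonal p.2 * p.1ᵀ) + σ ^ 2 • (1 : Matrix (Fin M) (Fin M) ℝ)

/-- The negative log-likelihood of the transformed data `Ỹ_i = Φ Y_i`, up to an additive constant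
and the factor `n`: `(1 / 2n) tr (Γ⁻¹ ∑ Ỹ_i Ỹ_iᵀ) + (1 / 2) log |Γ|`. -/
noncomputable def negLogLik {n m M r : ℕ} (Φ : Matrix (Fin M) (Fin m) ℝ) (s σ : ℝ)
    (y : Fin n → EuclideanSpace ℝ (Fin m)) (p : Matrix (Fin M) (Fin r) ℝ × (Fin r → ℝ)) : ℝ :=
  1 / (2 * (n : ℝ)) *
      ((modelCov s σ p)⁻¹ *
        ∑ i, Matrix.vecMulVec (Φ *ᵥ (y i).ofLp) (Φ *ᵥ (y i).ofLp)).trace +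
    1 / 2 * Real.log (modelCov s σ p).det

/-- `p` is a REML estimate for the data `y`: a minimizer of the negative log-likelihood over the
whole parameter space. -/
def IsReml {n m M r : ℕ} (Φ : Matrix (Fin M) (Fin m) ℝ) (s σ : ℝ)
    (y : Fin n → EuclideanSpace ℝ (Fin m)) (p : Matrix (Fin M) (Fin r) ℝ × (Fin r → ℝ)) : Prop :=
  p ∈ paramSpace M r ∧ IsMinOn (negLogLik Φ s σ y) (paramSpace M r) p

/-- The three error bounds, with Frobenius norms, for the estimate `p` of `q`. -/
def ErrorBounds {M r : ℕ} (s σ α : ℝ) (p q : Matrix (Fin M) (Fin r) ℝ × (Fin r → ℝ)) : Prop :=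
  ‖(1 - q.1 * q.1ᵀ) * (p.1 - q.1)‖ ≤ α ∧
  ‖q.1ᵀ * (p.1 - q.1)‖ ≤ √(s / σ ^ 2) * α ∧
  ‖Matrix.diagonal p.2 - Matrix.diagonal q.2‖ ≤ √(s / σ ^ 2) * α

end RemlMatrix

namespace RemlMatrix

/-! The likelihood depends on the data only through the sample covariance `S` of the projected
observations, and it has an explicit minimizer: the top `r` eigenvectors of `S`, with `Λ` read off
from the eigenvalues (`objective_le_of_top_eigenvectors`). No expansion of the likelihood is needed;
the theorem reduces to eigenvector perturbation.

The comparison between `S` and the model covariance `Γ` at the target parameter is made in relative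
form: `|xᵀ(S - Γ)x| ≤ δ xᵀΓx` for all `x`, with `δ` of order `√(M log n / n)`. By Cauchy–Schwarz
(`sq_dotProduct_mulVec_le`) the error between two directions is then weighted by their `Γ`-lengths.
A direction orthogonal to the columns of `B_*` has `Γ`-length `σ`, while a general unit vector has
`Γ`-length of order at most `√s`; dividing by a spectral gap of order `s` gives an error `δ σ/√s`
orthogonally to `B_*` and `δ` inside its range (`eigenvector_perturbation`). This is exactly the
difference between the rates in the three bounds.

The relative bound has two sources. The model error is at most a multiple of `ε σ²`, `ε = √(M log n
/ n)`, and `Γ ≥ σ²` makes it relative (`abs_form_sub_modelCov_le`). The sampling error is treated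
after whitening: a quadratic form is controlled by its values on a lattice cube of `(8M+1)^M`
points, at each of which a chi-square Chernoff bound applies (`measureReal_sampleCov_deviation_le`).
Finally the spectral gaps of the true covariance pass to `Λ_*` by Weyl's inequality
(`EigenvalueCondition.param_bounds`). -/

/-! ### Tail bounds for sums of squared Gaussians. -/

lemma neg_log_one_sub_le {y : ℝ} (hy : y ≤ 1 / 2) : -Real.log (1 - y) ≤ y + 2 * y ^ 2 := by
  have h := Real.one_sub_inv_le_log_of_pos (show 0 < 1 - y by linarith)
  have h2 : (1 - y)⁻¹ ≤ 1 + y + 2 * y ^ 2 := by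
    rw [inv_le_iff_one_le_mul₀ (by linarith)]
    nlinarith [mul_nonneg (sq_nonneg y) (show 0 ≤ 1 - 2 * y by linarith)]
  linarith

/-- The exponential moments of the square of a centred Gaussian variable. -/
lemma integral_exp_mul_sq_gaussianReal {v : NNReal} (hv : v ≠ 0) {t : ℝ} (ht : 2 * (t * v) < 1) :
    ∫ x, Real.exp (t * x ^ 2) ∂(gaussianReal 0 v) = (√(1 - 2 * (t * v)))⁻¹ := by
  have hv' : (0 : ℝ) < v := by positivity
  rw [integral_gaussianReal_eq_integral_smul hv]
  have h : ∀ x : ℝ, gaussianPDFReal 0 v x • Real.exp (t * x ^ 2) =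
      (√(2 * Real.pi * v))⁻¹ * Real.exp (-((1 - 2 * (t * v)) / (2 * v)) * x ^ 2) := by
    intro x
    rw [gaussianPDFReal, smul_eq_mul, mul_assoc, ← Real.exp_add]
    congr 2
    field_simp
    ring
  simp_rw [h]
  rw [integral_const_mul, integral_gaussian, ← Real.sqrt_inv, ← Real.sqrt_inv,
    ← Real.sqrt_mul (by positivity)]
  congr 1
  have : 1 - 2 * (t * v) ≠ 0 := by linarith
  field_simp

lemma integrable_exp_mul_sq_gaussianReal {v : NNReal} (hv : v ≠ 0) {t : ℝ}
    (ht : 2 * (t * v) < 1) : Integrable (fun x => Real.exp (t * x ^ 2)) (gaussianReal 0 v) := by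
  by_contra h
  have h1 := integral_exp_mul_sq_gaussianReal hv ht
  -- The integral of a non-integrable function is `0` by convention, but the closed formula is
  -- positive.
  rw [integral_undef h] at h1
  have : 0 < (√(1 - 2 * (t * v)))⁻¹ := by
    have : 0 < 1 - 2 * (t * v) := by linarith
    positivity
  linarith

/-- Second-order bound on the exact value `(1 - 2tv)^(-1/2)`; the restriction on `t` keeps `2tv ≤
1/2`, away from the singularity. -/
lemma mgf_sq_gaussian_le {Ω : Type*} [MeasurableSpace Ω] {P : Measure Ω} {X : Ω → ℝ}
    {v : NNReal} (hv : v ≠ 0) (hX : HasLaw X (gaussianReal 0 v) P) {t : ℝ} (ht : t * v ≤ 1 / 4) :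
    mgf (fun ω => X ω ^ 2) P t ≤ Real.exp (t * v + 4 * (t * v) ^ 2) := by
  have h1 : mgf (fun ω => X ω ^ 2) P t = ∫ x, Real.exp (t * x ^ 2) ∂(gaussianReal 0 v) := by
    rw [mgf]
    exact hX.integral_comp (f := fun x => Real.exp (t * x ^ 2))
      (Measurable.aestronglyMeasurable (by fun_prop))
  have hp : 0 < 1 - 2 * (t * v) := by linarith
  rw [h1, integral_exp_mul_sq_gaussianReal hv (by linarith), ← Real.exp_log (x := (√(1 - 2 * (t * v)))⁻¹)
    (by positivity), Real.log_inv, Real.log_sqrt hp.le]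
  apply Real.exp_le_exp.2
  have := neg_log_one_sub_le (y := 2 * (t * v)) (by linarith)
  linarith

lemma integrable_exp_mul_sq {Ω : Type*} [MeasurableSpace Ω] {P : Measure Ω} {X : Ω → ℝ}
    {v : NNReal} (hv : v ≠ 0) (hX : HasLaw X (gaussianReal 0 v) P) {t : ℝ} (ht : t * v ≤ 1 / 4) :
    Integrable (fun ω => Real.exp (t * X ω ^ 2)) P := by
  have h := integrable_exp_mul_sq_gaussianReal hv (t := t) (by linarith)
  rw [← hX.map_eq] at h
  exact h.comp_aemeasurable hX.aemeasurable

/-- A Bernstein-type bound for the empirical second moment of independent Gaussian variables. -/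
lemma measureReal_abs_sum_sq_sub_ge_le {Ω : Type*} [MeasurableSpace Ω] {P : Measure Ω}
    [IsProbabilityMeasure P] {n : ℕ} {X : Fin n → Ω → ℝ} {v : NNReal} (hv : v ≠ 0)
    (hX : ∀ i, HasLaw (X i) (gaussianReal 0 v) P) (hind : iIndepFun X P) {δ : ℝ} (hδ : 0 ≤ δ)
    (hδ1 : δ ≤ 1) :
    P.real {ω | n * (δ * v) ≤ |∑ i, X i ω ^ 2 - n * v|} ≤ 2 * Real.exp (-(n * δ ^ 2 / 16)) := by
  have hv' : (0 : ℝ) < v := by positivity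
  have hind2 : iIndepFun (fun i ω => X i ω ^ 2) P :=
    hind.comp (fun _ x => x ^ 2) (fun _ => by fun_prop)
  have hae : ∀ i, AEMeasurable (fun ω => X i ω ^ 2) P := fun i => (hX i).aemeasurable.pow_const 2
  have hprod : ∀ t : ℝ, mgf (fun ω => ∑ i, X i ω ^ 2) P t =
      ∏ i, mgf (fun ω => X i ω ^ 2) P t := by
    intro t
    have h := hind2.mgf_sum₀ (t := t) hae Finset.univ
    have e : (∑ i, fun ω => X i ω ^ 2) = fun ω => ∑ i, X i ω ^ 2 := by
      ext ω; simp
    rwa [e] at h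
  have hmgf : ∀ t : ℝ, t * v ≤ 1 / 4 → mgf (fun ω => ∑ i, X i ω ^ 2) P t ≤
      Real.exp (n * (t * v + 4 * (t * v) ^ 2)) := by
    intro t ht
    rw [hprod]
    refine (Finset.prod_le_prod (fun i _ => mgf_nonneg)
      (fun i _ => mgf_sq_gaussian_le hv (hX i) ht)).trans_eq ?_
    rw [Finset.prod_const, Finset.card_univ, Fintype.card_fin, ← Real.exp_nat_mul]
  have hint : ∀ t : ℝ, t * v ≤ 1 / 4 →
      Integrable (fun ω => Real.exp (t * ∑ i, X i ω ^ 2)) P := by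
    intro t ht
    by_contra h
    have h0 := hprod t
    rw [mgf_undef h] at h0
    exact (Finset.prod_pos fun i _ => mgf_pos (integrable_exp_mul_sq hv (hX i) ht)).ne h0
  have hup : P.real {ω | n * v * (1 + δ) ≤ ∑ i, X i ω ^ 2} ≤ Real.exp (-(n * δ ^ 2 / 16)) := by
    -- With `τ = tv` the Chernoff exponent per observation is `4τ² - δτ`; it is minimal at `τ =
    -- δ/8`, with value `-δ²/16`. The lower tail uses `-τ`.
    have ht : δ / (8 * v) * v = δ / 8 := by field_simp
    refine (measure_ge_le_exp_mul_mgf (X := fun ω => ∑ i, X i ω ^ 2) (t := δ / (8 * v)) _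
      (by positivity) (hint _ (by rw [ht]; linarith))).trans ?_
    refine (mul_le_mul_of_nonneg_left (hmgf _ (by rw [ht]; linarith)) (Real.exp_nonneg _)).trans ?_
    rw [← Real.exp_add, ht]
    apply Real.exp_le_exp.2
    apply le_of_eq
    field_simp
    ring
  have hlow : P.real {ω | ∑ i, X i ω ^ 2 ≤ n * v * (1 - δ)} ≤ Real.exp (-(n * δ ^ 2 / 16)) := by
    have ht : -(δ / (8 * v)) * v = -(δ / 8) := by field_simp
    refine (measure_le_le_exp_mul_mgf (X := fun ω => ∑ i, X i ω ^ 2) (t := -(δ / (8 * v))) _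
      (by simp only [Left.neg_nonpos_iff]; positivity) (hint _ (by rw [ht]; linarith))).trans ?_
    refine (mul_le_mul_of_nonneg_left (hmgf _ (by rw [ht]; linarith)) (Real.exp_nonneg _)).trans ?_
    rw [← Real.exp_add, ht]
    apply Real.exp_le_exp.2
    apply le_of_eq
    field_simp
    ring
  calc P.real {ω | n * (δ * v) ≤ |∑ i, X i ω ^ 2 - n * v|}
      ≤ P.real ({ω | n * v * (1 + δ) ≤ ∑ i, X i ω ^ 2} ∪
          {ω | ∑ i, X i ω ^ 2 ≤ n * v * (1 - δ)}) := by
        apply measureReal_mono _ (measure_ne_top _ _)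
        intro ω hω
        simp only [Set.mem_ofPred_eq, Set.mem_union, le_abs] at hω ⊢
        rcases hω with h | h
        · left; linarith
        · right; linarith
    _ ≤ _ := measureReal_union_le _ _
    _ ≤ 2 * Real.exp (-(n * δ ^ 2 / 16)) := by linarith

/-- Linear functionals of a centred Gaussian vector are Gaussian. -/
lemma hasLaw_dotProduct_gaussian {Ω : Type*} [MeasurableSpace Ω] {P : Measure Ω} {m : ℕ}
    {S : Matrix (Fin m) (Fin m) ℝ} (hS : S.PosSemidef) {Y : Ω → EuclideanSpace ℝ (Fin m)}
    (hY : HasLaw Y (multivariateGaussian 0 S) P) (x : Fin m → ℝ) :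
    HasLaw (fun ω => x ⬝ᵥ (Y ω).ofLp) (gaussianReal 0 (x ⬝ᵥ S *ᵥ x).toNNReal) P := by
  have h : HasLaw (innerSL ℝ (WithLp.toLp 2 x)) (gaussianReal 0 (x ⬝ᵥ S *ᵥ x).toNNReal)
      (multivariateGaussian 0 S) := by
    refine ⟨by fun_prop, ?_⟩
    rw [IsGaussian.map_eq_gaussianReal, ContinuousLinearMap.integral_comp_id_comm]
    · congr 1
      · simp
      · have := covarianceBilin_multivariateGaussian (μ := 0) hS (WithLp.toLp 2 x) (WithLp.toLp 2 x)
        rw [← this, covarianceBilin_self]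
        · congr 2
        · exact IsGaussian.memLp_two_id
    · exact IsGaussian.integrable_id
  have h2 := h.comp hY
  convert h2 using 1
  ext ω
  simp [PiLp.inner_apply, dotProduct, mul_comm]

/-! ### Quadratic forms and orthonormal columns. -/

section QuadraticForms

variable {ι κ : Type*} [Fintype ι] [Fintype κ]

lemma dotProduct_mul_diagonal_mul_transpose_mulVec [DecidableEq κ] (V : Matrix ι κ ℝ) (a : κ → ℝ) (x y : ι → ℝ) :
    x ⬝ᵥ (V * Matrix.diagonal a * Vᵀ) *ᵥ y = ∑ k, a k * ((Vᵀ *ᵥ x) k * (Vᵀ *ᵥ y) k) := by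
  rw [← Matrix.mulVec_mulVec, ← Matrix.mulVec_mulVec, Matrix.dotProduct_mulVec,
    ← Matrix.mulVec_transpose, dotProduct]
  refine Finset.sum_congr rfl fun k _ => ?_
  rw [Matrix.mulVec_diagonal]
  ring

lemma dotProduct_mulVec_transpose (V : Matrix ι κ ℝ) (x : ι → ℝ) (y : κ → ℝ) :
    x ⬝ᵥ V *ᵥ y = (Vᵀ *ᵥ x) ⬝ᵥ y := by
  rw [Matrix.dotProduct_mulVec, ← Matrix.mulVec_transpose]

lemma dotProduct_mulVec_comm {A : Matrix ι ι ℝ} (hA : Aᵀ = A) (x y : ι → ℝ) :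
    x ⬝ᵥ A *ᵥ y = y ⬝ᵥ A *ᵥ x := by
  rw [dotProduct_mulVec_transpose, hA, dotProduct_comm]

lemma dotProduct_mulVec_self_of_orthonormal [DecidableEq κ] {V : Matrix ι κ ℝ} (hV : Vᵀ * V = 1) (c d : κ → ℝ) :
    (V *ᵥ c) ⬝ᵥ (V *ᵥ d) = c ⬝ᵥ d := by
  rw [dotProduct_mulVec_transpose, Matrix.mulVec_mulVec, hV, Matrix.one_mulVec]

lemma dotProduct_self_eq_sum_sq (x : ι → ℝ) : x ⬝ᵥ x = ∑ i, x i ^ 2 := by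
  simp [dotProduct, sq]

lemma dotProduct_self_nonneg' (x : ι → ℝ) : 0 ≤ x ⬝ᵥ x := by
  rw [dotProduct_self_eq_sum_sq]
  positivity

/-- The Pythagorean decomposition along the columns of `V`. -/
lemma dotProduct_sub_proj_self [DecidableEq κ] {V : Matrix ι κ ℝ} (hV : Vᵀ * V = 1) (x : ι → ℝ) :
    (x - V *ᵥ (Vᵀ *ᵥ x)) ⬝ᵥ (x - V *ᵥ (Vᵀ *ᵥ x)) = x ⬝ᵥ x - ∑ k, (Vᵀ *ᵥ x) k ^ 2 := by
  rw [sub_dotProduct, dotProduct_sub, dotProduct_sub, dotProduct_mulVec_self_of_orthonormal hV,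
    dotProduct_comm (V *ᵥ (Vᵀ *ᵥ x)) x, dotProduct_mulVec_transpose, dotProduct_self_eq_sum_sq (Vᵀ *ᵥ x)]
  ring

/-- Bessel's inequality. -/
lemma sum_sq_transpose_mulVec_le [DecidableEq κ] {V : Matrix ι κ ℝ} (hV : Vᵀ * V = 1) (x : ι → ℝ) :
    ∑ k, (Vᵀ *ᵥ x) k ^ 2 ≤ x ⬝ᵥ x := by
  have h := dotProduct_self_nonneg' (x - V *ᵥ (Vᵀ *ᵥ x))
  rw [dotProduct_sub_proj_self hV] at h
  linarith

lemma sum_sq_transpose_mulVec_eq [DecidableEq ι] {U : Matrix ι ι ℝ} (hU : Uᵀ * U = 1) (x : ι → ℝ) :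
    ∑ k, (Uᵀ *ᵥ x) k ^ 2 = x ⬝ᵥ x := by
  have h := dotProduct_mulVec_self_of_orthonormal (V := Uᵀ)
    (by rw [Matrix.transpose_transpose]; exact mul_eq_one_comm.1 hU) x x
  rw [← h, dotProduct_self_eq_sum_sq]

lemma frobenius_norm_sq (A : Matrix ι κ ℝ) : ‖A‖ ^ 2 = ∑ i, ∑ k, A i k ^ 2 := by
  rw [Matrix.frobenius_norm_def, ← Real.rpow_natCast, ← Real.rpow_mul (by positivity)]
  simp

lemma abs_dotProduct_mulVec_le_frobenius (A : Matrix ι ι ℝ) (x : ι → ℝ) :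
    |x ⬝ᵥ A *ᵥ x| ≤ ‖A‖ * (x ⬝ᵥ x) := by
  have h1 : x ⬝ᵥ A *ᵥ x = ∑ p : ι × ι, A p.1 p.2 * (x p.1 * x p.2) := by
    rw [Fintype.sum_prod_type, dotProduct]
    refine Finset.sum_congr rfl fun i _ => ?_
    rw [Matrix.mulVec, dotProduct, Finset.mul_sum]
    exact Finset.sum_congr rfl fun j _ => by ring
  apply abs_le_of_sq_le_sq _ (mul_nonneg (norm_nonneg _) (dotProduct_self_nonneg' x))
  rw [h1, mul_pow, frobenius_norm_sq]
  refine (Finset.sum_mul_sq_le_sq_mul_sq _ _ _).trans_eq ?_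
  simp only [mul_pow]
  rw [Fintype.sum_prod_type, Fintype.sum_prod_type, dotProduct_self_eq_sum_sq, sq (∑ i, x i ^ 2)]
  congr 1
  rw [Finset.sum_mul_sum]

/-- A symmetric form dominated by a multiple of another form on the diagonal satisfies the
corresponding Cauchy–Schwarz bound. -/
lemma sq_dotProduct_mulVec_le {E G : Matrix ι ι ℝ} (hE : Eᵀ = E) (hG : Gᵀ = G) {δ : ℝ}
    (h : ∀ x, |x ⬝ᵥ E *ᵥ x| ≤ δ * (x ⬝ᵥ G *ᵥ x)) (x y : ι → ℝ) :
    (x ⬝ᵥ E *ᵥ y) ^ 2 ≤ δ ^ 2 * (x ⬝ᵥ G *ᵥ x) * (y ⬝ᵥ G *ᵥ y) := by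
  -- Polarization: compare the two forms at `t x + y` and `t x - y` and subtract. The discriminant
  -- of this nonnegative quadratic in `t` gives the claim.
  have key : ∀ t : ℝ, 0 ≤ δ * (x ⬝ᵥ G *ᵥ x) * (t * t) + (-(2 * (x ⬝ᵥ E *ᵥ y))) * t +
      δ * (y ⬝ᵥ G *ᵥ y) := by
    intro t
    have h1 := (abs_le.1 (h (t • x + y))).2
    have h2 := (abs_le.1 (h (t • x - y))).1
    simp only [Matrix.mulVec_add, Matrix.mulVec_sub, Matrix.mulVec_smul, add_dotProduct,
      sub_dotProduct, dotProduct_add, dotProduct_sub, smul_dotProduct, dotProduct_smul,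
      smul_eq_mul, dotProduct_mulVec_comm hE y x, dotProduct_mulVec_comm hG y x] at h1 h2
    linarith
  have := discrim_le_zero key
  rw [discrim] at this
  linarith

end QuadraticForms

/-! ### Ordered eigenvalues and their comparison. -/

section Eigenvalues

lemma sortedEigenvalue_nonneg {m : ℕ} {A : Matrix (Fin m) (Fin m) ℝ} (hA : A.PosSemidef) (j : ℕ) :
    0 ≤ sortedEigenvalue hA.isHermitian j := by
  unfold sortedEigenvalue
  split_ifs with h
  · have := hA.eigenvalues_nonneg
      ((Fintype.equivOfCardEq (Fintype.card_fin _)) (⟨j, by simpa using h⟩ : Fin (Fintype.card (Fin m))))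
    rwa [Matrix.IsHermitian.eigenvalues, Equiv.symm_apply_apply] at this
  · exact le_rfl

lemma sortedEigenvalue_antitoneOn {m : ℕ} {A : Matrix (Fin m) (Fin m) ℝ} (hA : A.IsHermitian)
    {i j : ℕ} (hij : i ≤ j) (hj : j < m) : sortedEigenvalue hA j ≤ sortedEigenvalue hA i := by
  unfold sortedEigenvalue
  rw [dif_pos hj, dif_pos (hij.trans_lt hj)]
  exact hA.eigenvalues₀_antitone hij

/-- Diagonalization with the eigenvalues in decreasing order. -/
lemma exists_sorted_diagonalization {m : ℕ} {A : Matrix (Fin m) (Fin m) ℝ} (hA : A.IsHermitian) :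
    ∃ U : Matrix (Fin m) (Fin m) ℝ, Uᵀ * U = 1 ∧
      A = U * Matrix.diagonal (fun j : Fin m => sortedEigenvalue hA j) * Uᵀ := by
  let e : Fin m ≃ Fin m := (finCongr (Fintype.card_fin m).symm).trans
    (Fintype.equivOfCardEq (Fintype.card_fin _))
  have he : (fun j : Fin m => sortedEigenvalue hA j) = fun j => hA.eigenvalues (e j) := by
    ext j
    simp [sortedEigenvalue, Matrix.IsHermitian.eigenvalues, e]
    rfl
  let V : Matrix (Fin m) (Fin m) ℝ := hA.eigenvectorUnitary
  have hV : Vᵀ * V = 1 := Unitary.coe_star_mul_self hA.eigenvectorUnitary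
  have hsp : A = V * Matrix.diagonal hA.eigenvalues * Vᵀ := hA.spectral_theorem
  refine ⟨V.submatrix id e, ?_, ?_⟩
  · rw [Matrix.transpose_submatrix, ← Matrix.submatrix_mul _ _ _ _ _ Function.bijective_id, hV]
    simp
  · rw [he]
    conv_lhs => rw [hsp]
    have : Matrix.diagonal (fun j => hA.eigenvalues (e j)) =
        (Matrix.diagonal hA.eigenvalues).submatrix e e := by
      rw [Matrix.submatrix_diagonal_equiv]; rfl
    rw [this, Matrix.transpose_submatrix, Matrix.submatrix_mul_equiv, Matrix.submatrix_mul_equiv,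
      Matrix.submatrix_id_id]

/-- Eigenvalue comparison for quadratic forms (Weyl, by the Courant–Fischer dimension count). -/
lemma eigenvalue_le_of_form_le {d p q : ℕ} {V : Matrix (Fin d) (Fin p) ℝ} (hV : Vᵀ * V = 1)
    {W : Matrix (Fin d) (Fin q) ℝ} (hW : Wᵀ * W = 1) {a : Fin p → ℝ} {b : Fin q → ℝ}
    (ha : Antitone a) (hb : Antitone b) (hb0 : ∀ i, 0 ≤ b i) {β γ : ℝ}
    (hβ : 0 ≤ β)
    (h : ∀ x : Fin d → ℝ, ∑ k, a k * (Vᵀ *ᵥ x) k ^ 2 ≤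
      β * ∑ k, b k * (Wᵀ *ᵥ x) k ^ 2 + γ * (x ⬝ᵥ x))
    {j : ℕ} (hjp : j < p) (hjq : j < q) : a ⟨j, hjp⟩ ≤ β * b ⟨j, hjq⟩ + γ := by
  let ι : (Fin (j + 1) → ℝ) →ₗ[ℝ] (Fin p → ℝ) :=
    (Matrix.of fun (k : Fin p) (i : Fin (j + 1)) => if (k : ℕ) = i then (1 : ℝ) else 0).mulVecLin
  have hι : ∀ c k, ι c k = if hk : (k : ℕ) < j + 1 then c ⟨k, hk⟩ else 0 := by
    intro c k
    simp only [ι, Matrix.mulVecLin_apply, Matrix.mulVec, dotProduct, Matrix.of_apply, ite_mul,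
      one_mul, zero_mul]
    split_ifs with hk
    · rw [Finset.sum_eq_single ⟨k, hk⟩]
      · simp
      · intro i _ hi
        rw [if_neg]
        intro h'
        exact hi (Fin.ext h'.symm)
      · simp
    · refine Finset.sum_eq_zero fun i _ => if_neg ?_
      have := i.2
      omega
  let ρ : (Fin q → ℝ) →ₗ[ℝ] (Fin j → ℝ) := LinearMap.funLeft ℝ ℝ (Fin.castLE hjq.le)
  -- The span of the first `j + 1` columns of `V` contains a nonzero vector orthogonal to the first
  -- `j` columns of `W`; the hypothesis is tested on it.
  let f : (Fin (j + 1) → ℝ) →ₗ[ℝ] (Fin j → ℝ) := ρ ∘ₗ Wᵀ.mulVecLin ∘ₗ V.mulVecLin ∘ₗ ι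
  have hker : LinearMap.ker f ≠ ⊥ := LinearMap.ker_ne_bot_of_finrank_lt (by simp)
  obtain ⟨c, hc, hc0⟩ := (Submodule.ne_bot_iff _).1 hker
  set x := V *ᵥ ι c with hx
  have hVx : Vᵀ *ᵥ x = ι c := by rw [hx, Matrix.mulVec_mulVec, hV, Matrix.one_mulVec]
  have hxx : x ⬝ᵥ x = ∑ k, ι c k ^ 2 := by
    rw [hx, dotProduct_mulVec_self_of_orthonormal hV, dotProduct_self_eq_sum_sq]
  have hpos : 0 < x ⬝ᵥ x := by
    rw [hxx]
    obtain ⟨i, hi⟩ := Function.ne_iff.1 hc0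
    have hip : (i : ℕ) < p := by have := i.2; omega
    refine Finset.sum_pos' (fun _ _ => sq_nonneg _) ⟨⟨i, hip⟩, Finset.mem_univ _, ?_⟩
    rw [hι, dif_pos i.2]
    exact sq_pos_of_ne_zero hi
  have hWx : ∀ k : Fin q, (k : ℕ) < j → (Wᵀ *ᵥ x) k = 0 := by
    intro k hk
    exact congrFun (LinearMap.mem_ker.1 hc) ⟨k, hk⟩
  have h1 : a ⟨j, hjp⟩ * (x ⬝ᵥ x) ≤ ∑ k, a k * (Vᵀ *ᵥ x) k ^ 2 := by
    rw [hxx, hVx, Finset.mul_sum]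
    refine Finset.sum_le_sum fun k _ => ?_
    by_cases hk : (k : ℕ) < j + 1
    · exact mul_le_mul_of_nonneg_right (ha (show k ≤ ⟨j, hjp⟩ from Nat.lt_succ_iff.1 hk))
        (sq_nonneg _)
    · rw [hι, dif_neg hk]; simp
  have h2 : ∑ k, b k * (Wᵀ *ᵥ x) k ^ 2 ≤ b ⟨j, hjq⟩ * (x ⬝ᵥ x) := by
    refine le_trans ?_ (mul_le_mul_of_nonneg_left (sum_sq_transpose_mulVec_le hW x) (hb0 _))
    rw [Finset.mul_sum]
    refine Finset.sum_le_sum fun k _ => ?_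
    by_cases hk : (k : ℕ) < j
    · rw [hWx k hk]; simp
    · exact mul_le_mul_of_nonneg_right (hb (show ⟨j, hjq⟩ ≤ k from not_lt.1 hk)) (sq_nonneg _)
  have h3 := h x
  have h4 := mul_le_mul_of_nonneg_left h2 hβ
  have h5 : a ⟨j, hjp⟩ * (x ⬝ᵥ x) ≤ (β * b ⟨j, hjq⟩ + γ) * (x ⬝ᵥ x) := by linarith
  exact le_of_mul_le_mul_right h5 hpos

end Eigenvalues

/-! ### Discretization of quadratic forms. -/

section Lattice

lemma isHermitian_of_transpose_eq {ι : Type*} {A : Matrix ι ι ℝ} (h : Aᵀ = A) : A.IsHermitian := by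
  rw [Matrix.IsHermitian, Matrix.conjTranspose_eq_transpose_of_trivial, h]

/-- A quadratic form on `ℝ^M` is controlled by its values on the lattice points of a cube. -/
lemma abs_form_le_of_lattice {M : ℕ} {T : Matrix (Fin M) (Fin M) ℝ} (hT : Tᵀ = T) {δ : ℝ}
    (hδ : 0 ≤ δ) (hM : 0 < M) (h : ∀ z ∈ Fintype.piFinset fun _ : Fin M => Finset.Icc (-(4 * M : ℤ)) (4 * M),
      |(fun i => (z i : ℝ)) ⬝ᵥ T *ᵥ (fun i => (z i : ℝ))| ≤
        δ * ((fun i => (z i : ℝ)) ⬝ᵥ (fun i => (z i : ℝ)))) (x : Fin M → ℝ) :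
    |x ⬝ᵥ T *ᵥ x| ≤ 4 * δ * (x ⬝ᵥ x) := by
  obtain ⟨U, hU, hTU⟩ := exists_sorted_diagonalization (isHermitian_of_transpose_eq hT)
  set ℓ : Fin M → ℝ := fun j => sortedEigenvalue (isHermitian_of_transpose_eq hT) j with hℓ
  have : Nonempty (Fin M) := ⟨⟨0, hM⟩⟩
  obtain ⟨i₀, hi₀⟩ := Finite.exists_max fun i => |ℓ i|
  set L := |ℓ i₀| with hL
  have hL0 : 0 ≤ L := abs_nonneg _
  have hform : ∀ y : Fin M → ℝ, |y ⬝ᵥ T *ᵥ y| ≤ L * (y ⬝ᵥ y) := by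
    intro y
    rw [hTU, dotProduct_mul_diagonal_mul_transpose_mulVec, ← sum_sq_transpose_mulVec_eq hU y,
      Finset.mul_sum]
    refine (Finset.abs_sum_le_sum_abs _ _).trans (Finset.sum_le_sum fun k _ => ?_)
    rw [abs_mul, ← sq, abs_sq]
    exact mul_le_mul_of_nonneg_right (hi₀ k) (sq_nonneg _)
  suffices hLδ : L ≤ 4 * δ from
    (hform x).trans (mul_le_mul_of_nonneg_right hLδ (dotProduct_self_nonneg' x))
  set u : Fin M → ℝ := U *ᵥ Pi.single i₀ 1 with hu
  have huu : u ⬝ᵥ u = 1 := by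
    rw [hu, dotProduct_mulVec_self_of_orthonormal hU]; simp
  have hTu : T *ᵥ u = ℓ i₀ • u := by
    rw [hTU, hu, Matrix.mulVec_mulVec, Matrix.mul_assoc, hU, Matrix.mul_one, ← Matrix.mulVec_mulVec,
      Matrix.diagonal_mulVec_single, ← Matrix.mulVec_smul, mul_one]
    congr 1
    ext i; simp [Pi.single_apply]
  have hMr : (0 : ℝ) < M := by exact_mod_cast hM
  have hui : ∀ i, |u i| ≤ 1 := by
    intro i
    rw [← sq_le_one_iff_abs_le_one, ← huu, dotProduct_self_eq_sum_sq]
    exact Finset.single_le_sum (f := fun i => u i ^ 2) (fun _ _ => sq_nonneg _) (Finset.mem_univ i)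
  -- Rounding the dilated top eigenvector `4M u` moves each coordinate by at most `1`, hence the
  -- vector by at most `√M`, against length `4M`.
  let z : Fin M → ℤ := fun i => ⌊4 * M * u i⌋
  have hz : z ∈ Fintype.piFinset fun _ : Fin M => Finset.Icc (-(4 * M : ℤ)) (4 * M) := by
    rw [Fintype.mem_piFinset]
    intro i
    obtain ⟨h1, h2⟩ := abs_le.1 (hui i)
    rw [Finset.mem_Icc]
    constructor
    · apply Int.le_floor.2
      push_cast
      nlinarith
    · have : (z i : ℝ) ≤ 4 * M := (Int.floor_le _).trans (by nlinarith)
      exact_mod_cast this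
  set w : Fin M → ℝ := fun i => (z i : ℝ) - 4 * M * u i with hw
  have hw1 : w ⬝ᵥ w ≤ M := by
    rw [dotProduct_self_eq_sum_sq]
    calc ∑ i, w i ^ 2 ≤ ∑ i : Fin M, (1 : ℝ) := by
          refine Finset.sum_le_sum fun i _ => ?_
          have h1 := Int.floor_le (4 * M * u i)
          have h2 := Int.lt_floor_add_one (4 * M * u i)
          rw [sq_le_one_iff_abs_le_one, abs_le]
          constructor <;> simp only [w, z] <;> linarith
      _ = M := by simp
  have hzw : (fun i => (z i : ℝ)) = (4 * M : ℝ) • u + w := by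
    ext i; simp [w]
  have h1 := h z hz
  rw [hzw] at h1
  have hM1 : (1 : ℝ) ≤ M := by exact_mod_cast hM
  have hwu : |w ⬝ᵥ u| ≤ M := by
    apply abs_le_of_sq_le_sq _ hMr.le
    have := Finset.sum_mul_sq_le_sq_mul_sq Finset.univ w u
    rw [← dotProduct_self_eq_sum_sq, ← dotProduct_self_eq_sum_sq, huu] at this
    refine this.trans ?_
    nlinarith
  have hww := hform w
  have e1 : ((4 * M : ℝ) • u + w) ⬝ᵥ T *ᵥ ((4 * M : ℝ) • u + w) =
      16 * M ^ 2 * ℓ i₀ + 8 * M * ℓ i₀ * (w ⬝ᵥ u) + w ⬝ᵥ T *ᵥ w := by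
    have e : u ⬝ᵥ T *ᵥ w = ℓ i₀ * (w ⬝ᵥ u) := by
      rw [dotProduct_mulVec_comm hT, hTu, dotProduct_smul, smul_eq_mul]
    simp only [Matrix.mulVec_add, Matrix.mulVec_smul, add_dotProduct, dotProduct_add,
      smul_dotProduct, dotProduct_smul, smul_eq_mul, e, hTu, huu]
    ring
  have e2 : ((4 * M : ℝ) • u + w) ⬝ᵥ ((4 * M : ℝ) • u + w) =
      16 * M ^ 2 + 8 * M * (w ⬝ᵥ u) + w ⬝ᵥ w := by
    simp only [add_dotProduct, dotProduct_add, smul_dotProduct, dotProduct_smul, smul_eq_mul,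
      huu, dotProduct_comm u w]
    ring
  rw [e1, e2] at h1
  have h3 : 16 * M ^ 2 * L ≤ |16 * M ^ 2 * ℓ i₀ + 8 * M * ℓ i₀ * (w ⬝ᵥ u) + w ⬝ᵥ T *ᵥ w| +
      8 * M * L * |w ⬝ᵥ u| + |w ⬝ᵥ T *ᵥ w| := by
    have e3 : 16 * (M : ℝ) ^ 2 * L = |16 * M ^ 2 * ℓ i₀| := by
      rw [abs_mul, abs_of_nonneg (by positivity)]
    have e4 : 8 * (M : ℝ) * L * |w ⬝ᵥ u| = |8 * M * ℓ i₀ * (w ⬝ᵥ u)| := by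
      rw [abs_mul, abs_mul, abs_of_nonneg (show (0 : ℝ) ≤ 8 * M by positivity)]
    rw [e3, e4]
    have := abs_sub (16 * M ^ 2 * ℓ i₀ + 8 * M * ℓ i₀ * (w ⬝ᵥ u) + w ⬝ᵥ T *ᵥ w)
      (8 * M * ℓ i₀ * (w ⬝ᵥ u) + w ⬝ᵥ T *ᵥ w)
    have h6 := abs_add_le (8 * M * ℓ i₀ * (w ⬝ᵥ u)) (w ⬝ᵥ T *ᵥ w)
    have e5 : 16 * M ^ 2 * ℓ i₀ + 8 * M * ℓ i₀ * (w ⬝ᵥ u) + w ⬝ᵥ T *ᵥ w -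
      (8 * M * ℓ i₀ * (w ⬝ᵥ u) + w ⬝ᵥ T *ᵥ w) = 16 * M ^ 2 * ℓ i₀ := by ring
    rw [e5] at this
    linarith
  have h4 := (abs_le.1 hwu).2
  have h5 : 8 * M * L * |w ⬝ᵥ u| ≤ 8 * M * L * M :=
    mul_le_mul_of_nonneg_left hwu (by positivity)
  have h6 : |w ⬝ᵥ T *ᵥ w| ≤ L * (M * M) :=
    hww.trans (mul_le_mul_of_nonneg_left (by nlinarith) hL0)
  have h7 : δ * (16 * M ^ 2 + 8 * M * (w ⬝ᵥ u) + w ⬝ᵥ w) ≤ δ * (25 * (M * M)) :=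
    mul_le_mul_of_nonneg_left (by nlinarith) hδ
  have hMM : (0 : ℝ) < M * M := by positivity
  -- The main term `16 L` loses `8 L` to the cross term and `L` to the remainder, while the squared
  -- length of the lattice point is at most `(16 + 8 + 1) M²`.
  have h8 : (7 * L) * (M * M) ≤ (25 * δ) * (M * M) := by nlinarith
  have := le_of_mul_le_mul_right h8 hMM
  linarith

end Lattice

/-! ### The explicit minimizer of the likelihood. -/

section Likelihood

variable {M r : ℕ} {s σ : ℝ} {p : Matrix (Fin M) (Fin r) ℝ × (Fin r → ℝ)}

lemma modelCov_inv (hσ : 0 < σ) (hs : 0 ≤ s) (hp : p ∈ paramSpace M r) :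
    (modelCov s σ p)⁻¹ = (σ ^ 2)⁻¹ • (1 : Matrix (Fin M) (Fin M) ℝ) -
      p.1 * Matrix.diagonal (fun k => (σ ^ 2)⁻¹ - (s * p.2 k + σ ^ 2)⁻¹) * p.1ᵀ := by
  apply Matrix.inv_eq_right_inv
  obtain ⟨B, Λ⟩ := p
  obtain ⟨hB, hΛ⟩ := hp
  simp only [modelCov] at hB hΛ ⊢
  set D := Matrix.diagonal (fun k => (σ ^ 2)⁻¹ - (s * Λ k + σ ^ 2)⁻¹) with hD
  have hσ2 : σ ^ 2 ≠ 0 := by positivity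
  have h1 : B * Matrix.diagonal Λ * Bᵀ * (B * D * Bᵀ) =
      B * (Matrix.diagonal Λ * D) * Bᵀ := by
    calc _ = B * Matrix.diagonal Λ * (Bᵀ * B) * D * Bᵀ := by simp only [Matrix.mul_assoc]
      _ = _ := by rw [hB, Matrix.mul_one]; simp only [Matrix.mul_assoc]
  have h2 : s • (Matrix.diagonal Λ * D) = (s * (σ ^ 2)⁻¹) • Matrix.diagonal Λ - σ ^ 2 • D := by
    rw [hD, Matrix.diagonal_mul_diagonal, ← Matrix.diagonal_smul, ← Matrix.diagonal_smul,
      ← Matrix.diagonal_smul, Matrix.diagonal_sub]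
    congr 1
    ext k
    have : s * Λ k + σ ^ 2 ≠ 0 := by have := hΛ k; positivity
    simp only [Pi.smul_apply, smul_eq_mul]
    field_simp
    ring
  rw [add_mul, mul_sub, mul_sub, smul_mul_assoc s, smul_mul_assoc s, h1, smul_mul_assoc,
    smul_mul_assoc, Matrix.one_mul, Matrix.one_mul, Matrix.mul_smul, Matrix.mul_one, smul_smul,
    smul_smul, mul_inv_cancel₀ hσ2, one_smul]
  have h3 : s • (B * (Matrix.diagonal Λ * D) * Bᵀ) =
      (s * (σ ^ 2)⁻¹) • (B * Matrix.diagonal Λ * Bᵀ) - σ ^ 2 • (B * D * Bᵀ) := by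
    rw [← Matrix.smul_mul, ← Matrix.mul_smul, h2, Matrix.mul_sub, Matrix.sub_mul, Matrix.mul_smul,
      Matrix.mul_smul, Matrix.smul_mul, Matrix.smul_mul]
  rw [h3]
  abel

/-- By Sylvester's determinant identity the determinant reduces to an `r × r` diagonal one. -/
lemma log_det_modelCov (hσ : 0 < σ) (hs : 0 ≤ s) (hp : p ∈ paramSpace M r) :
    Real.log (modelCov s σ p).det =
      M * Real.log (σ ^ 2) + ∑ k, Real.log ((s * p.2 k + σ ^ 2) / σ ^ 2) := by
  obtain ⟨B, Λ⟩ := p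
  obtain ⟨hB, hΛ⟩ := hp
  simp only [modelCov] at hB hΛ ⊢
  have hσ2 : σ ^ 2 ≠ 0 := by positivity
  have h1 : s • (B * Matrix.diagonal Λ * Bᵀ) + σ ^ 2 • (1 : Matrix (Fin M) (Fin M) ℝ) =
      σ ^ 2 • (1 + B * ((s / σ ^ 2) • Matrix.diagonal Λ * Bᵀ)) := by
    rw [smul_add, add_comm, Matrix.smul_mul, Matrix.mul_smul, smul_smul, mul_div_cancel₀ _ hσ2,
      Matrix.mul_assoc]
  have h2 : (1 : Matrix (Fin r) (Fin r) ℝ) + (s / σ ^ 2) • Matrix.diagonal Λ * Bᵀ * B =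
      Matrix.diagonal fun k => (s * Λ k + σ ^ 2) / σ ^ 2 := by
    rw [Matrix.mul_assoc, hB, Matrix.mul_one, ← Matrix.diagonal_one, ← Matrix.diagonal_smul,
      Matrix.diagonal_add]
    congr 1
    ext k
    simp only [Pi.smul_apply, smul_eq_mul]
    field_simp
    ring
  have h3 : ∀ k, 0 < (s * Λ k + σ ^ 2) / σ ^ 2 := fun k => by have := hΛ k; positivity
  rw [h1, Matrix.det_smul, Matrix.det_one_add_mul_comm, h2, Matrix.det_diagonal, Fintype.card_fin,
    Real.log_mul (by positivity) (Finset.prod_pos fun k _ => h3 k).ne', Real.log_pow,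
    Real.log_prod fun k _ => (h3 k).ne']

/-- The contribution of one component with variance `μ` and empirical second moment `q`. -/
noncomputable def componentLoss (v μ q : ℝ) : ℝ := Real.log (μ / v) - (v⁻¹ - μ⁻¹) * q

/-- As a function of `μ` the loss is `log μ + q/μ` plus a constant, which for `q > 0` falls until `μ
= q` and then rises, and for `q ≤ 0` only rises; so the constraint `μ ≥ v` truncates the optimum at
`v`. -/
lemma componentLoss_min {v μ q : ℝ} (hv : 0 < v) (hμ : v ≤ μ) :
    componentLoss v (max q v) q ≤ componentLoss v μ q := by
  unfold componentLoss
  set m := max q v with hm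
  have hvm : v ≤ m := le_max_right _ _
  have hm0 : 0 < m := hv.trans_le hvm
  have hμ0 : 0 < μ := hv.trans_le hμ
  have h1 := Real.one_sub_inv_le_log_of_pos (show 0 < μ / m by positivity)
  rw [Real.log_div hμ0.ne' hm0.ne', inv_div] at h1
  rw [Real.log_div hμ0.ne' hv.ne', Real.log_div hm0.ne' hv.ne']
  have h2 : 0 ≤ (m - q) * (m⁻¹ - μ⁻¹) := by
    rcases le_total v q with h | h
    · rw [hm, max_eq_left h, sub_self, zero_mul]
    · have : m = v := by rw [hm, max_eq_right h]
      rw [this]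
      exact mul_nonneg (sub_nonneg.2 h) (sub_nonneg.2 (inv_anti₀ hv hμ))
  have h3 : (m - q) * (m⁻¹ - μ⁻¹) = 1 - m / μ - q * m⁻¹ + q * μ⁻¹ := by
    field_simp
    ring
  linarith

/-- For fixed `μ ≥ v` the loss is affine in `q` with slope at most `0`, so its minimum over `μ` is
antitone; the optimal `μ` for the smaller `q` serves as competitor. -/
lemma componentLoss_min_antitone {v : ℝ} (hv : 0 < v) :
    Antitone fun q => componentLoss v (max q v) q := by
  intro q q' h
  refine (componentLoss_min hv (le_max_right q v)).trans ?_
  unfold componentLoss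
  have : 0 ≤ v⁻¹ - (max q v)⁻¹ := sub_nonneg.2 (inv_anti₀ hv (le_max_right _ _))
  nlinarith

/-- The objective decouples over the columns `b_k` of `B`: each enters only through `b_kᵀ S b_k`, an
average of the eigenvalues `ℓ j` with weights `(Uᵀ B)_{jk}²`. -/
lemma objective_eq (hσ : 0 < σ) (hs : 0 ≤ s) (hp : p ∈ paramSpace M r)
    (U : Matrix (Fin M) (Fin M) ℝ) (ℓ : Fin M → ℝ) {S : Matrix (Fin M) (Fin M) ℝ}
    (hS : S = U * Matrix.diagonal ℓ * Uᵀ) :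
    ((modelCov s σ p)⁻¹ * S).trace + Real.log (modelCov s σ p).det =
      (σ ^ 2)⁻¹ * S.trace + M * Real.log (σ ^ 2) +
        ∑ k, componentLoss (σ ^ 2) (s * p.2 k + σ ^ 2) (∑ j, (Uᵀ * p.1) j k ^ 2 * ℓ j) := by
  rw [log_det_modelCov hσ hs hp, modelCov_inv hσ hs hp, Matrix.sub_mul, Matrix.trace_sub,
    Matrix.smul_mul, Matrix.one_mul, Matrix.trace_smul, smul_eq_mul]
  simp only [componentLoss, Finset.sum_sub_distrib]
  have : (p.1 * Matrix.diagonal (fun k => (σ ^ 2)⁻¹ - (s * p.2 k + σ ^ 2)⁻¹) * p.1ᵀ * S).trace =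
      ∑ k, ((σ ^ 2)⁻¹ - (s * p.2 k + σ ^ 2)⁻¹) * ∑ j, (Uᵀ * p.1) j k ^ 2 * ℓ j := by
    rw [Matrix.mul_assoc, Matrix.mul_assoc, Matrix.trace_mul_comm, Matrix.mul_assoc, Matrix.trace]
    refine Finset.sum_congr rfl fun k _ => ?_
    rw [Matrix.diag_apply, Matrix.diagonal_mul]
    congr 1
    have e : p.1ᵀ * S * p.1 = (Uᵀ * p.1)ᵀ * Matrix.diagonal ℓ * (Uᵀ * p.1) := by
      rw [hS, Matrix.transpose_mul, Matrix.transpose_transpose]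
      simp only [Matrix.mul_assoc]
    rw [e, Matrix.mul_apply]
    refine Finset.sum_congr rfl fun j _ => ?_
    rw [Matrix.mul_diagonal, Matrix.transpose_apply]
    ring
  rw [this]
  ring

/-- A weighted sum with weights in `[0, 1]` of total mass `r` is at least the sum of the `r`
smallest terms. -/
lemma sum_le_sum_mul_of_extremal {ι : Type*} [Fintype ι] {e : Fin r → ι}
    (he : Function.Injective e) {g w : ι → ℝ} (hg : ∀ k, ∀ j ∉ Set.range e, g (e k) ≤ g j)
    (hw0 : ∀ j, 0 ≤ w j) (hw1 : ∀ j, w j ≤ 1) (hw : ∑ j, w j = r) :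
    ∑ k, g (e k) ≤ ∑ j, w j * g j := by
  classical
  rcases Nat.eq_zero_or_pos r with h0 | hr
  · subst h0
    have : ∀ j, w j = 0 := fun j =>
      (Finset.sum_eq_zero_iff_of_nonneg fun j _ => hw0 j).1 (by simpa using hw) j (Finset.mem_univ j)
    simp [this]
  have : Nonempty (Fin r) := ⟨⟨0, hr⟩⟩
  obtain ⟨k₀, hk₀⟩ := Finite.exists_max fun k => g (e k)
  -- After subtracting the largest selected value, selected terms are nonpositive and the others
  -- nonnegative, so the bounds on the weights can be used termwise.
  set c := g (e k₀) with hc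
  have h1 : ∑ k, (g (e k) - c) ≤ ∑ j, w j * (g j - c) := by
    have e1 : ∑ k, (g (e k) - c) = ∑ j ∈ Finset.univ.image e, (g j - c) := by
      rw [Finset.sum_image fun a _ b _ h => he h]
    rw [e1, ← Finset.sum_add_sum_compl (Finset.univ.image e) fun j => w j * (g j - c)]
    have h2 : ∑ j ∈ Finset.univ.image e, (g j - c) ≤
        ∑ j ∈ Finset.univ.image e, w j * (g j - c) := by
      refine Finset.sum_le_sum fun j hj => ?_
      obtain ⟨k, -, rfl⟩ := Finset.mem_image.1 hj
      have := hk₀ k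
      nlinarith [hw1 (e k)]
    have h3 : 0 ≤ ∑ j ∈ (Finset.univ.image e)ᶜ, w j * (g j - c) := by
      refine Finset.sum_nonneg fun j hj => mul_nonneg (hw0 j) (sub_nonneg.2 (hg k₀ j ?_))
      rintro ⟨k, rfl⟩
      simp at hj
    linarith
  simp only [mul_sub, Finset.sum_sub_distrib, ← Finset.sum_mul, hw] at h1
  simp at h1
  linarith

/-- Since the loss is affine in `q`, the average over eigenvalues can be taken outside, and each
term is bounded below by its profiled loss `g j`. The squares of `Uᵀ B` have column sums `1` and row
sums at most `1`, so the total is at least the sum of the `r` smallest `g j`, attained at the top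
eigenvalues. The condition `σ² < ℓ (e k)` keeps the resulting `Λ` positive; the signs `ε` are free.
-/
lemma objective_le_of_top_eigenvectors (hσ : 0 < σ) (hs : 0 < s)
    {U : Matrix (Fin M) (Fin M) ℝ} (hU : Uᵀ * U = 1) {ℓ : Fin M → ℝ}
    {S : Matrix (Fin M) (Fin M) ℝ} (hS : S = U * Matrix.diagonal ℓ * Uᵀ)
    {e : Fin r → Fin M} (he : Function.Injective e)
    (htop : ∀ k, ∀ j ∉ Set.range e, ℓ j ≤ ℓ (e k)) (hℓ : ∀ k, σ ^ 2 < ℓ (e k))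
    {ε : Fin r → ℝ} (hε : ∀ k, ε k ^ 2 = 1) {q : Matrix (Fin M) (Fin r) ℝ × (Fin r → ℝ)}
    (hq : q = (Matrix.of fun i k => ε k * U i (e k), fun k => (ℓ (e k) - σ ^ 2) / s)) :
    q ∈ paramSpace M r ∧ ∀ p ∈ paramSpace M r,
      ((modelCov s σ q)⁻¹ * S).trace + Real.log (modelCov s σ q).det ≤
        ((modelCov s σ p)⁻¹ * S).trace + Real.log (modelCov s σ p).det := by
  have hσ2 : 0 < σ ^ 2 := by positivity
  have hUq : ∀ j k, (Uᵀ * q.1) j k = if j = e k then ε k else 0 := by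
    intro j k
    have h := congrFun (congrFun hU j) (e k)
    rw [Matrix.mul_apply] at h ⊢
    simp only [hq, Matrix.of_apply, Matrix.one_apply] at h ⊢
    have : ∑ i, Uᵀ j i * (ε k * U i (e k)) = ε k * ∑ i, Uᵀ j i * U i (e k) := by
      rw [Finset.mul_sum]
      exact Finset.sum_congr rfl fun i _ => by ring
    rw [this, h]
    split_ifs <;> simp
  have hqmem : q ∈ paramSpace M r := by
    constructor
    · have h1 : q.1ᵀ * q.1 = (Uᵀ * q.1)ᵀ * (Uᵀ * q.1) := by
        rw [Matrix.transpose_mul, Matrix.transpose_transpose, Matrix.mul_assoc,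
          ← Matrix.mul_assoc U, mul_eq_one_comm.1 hU, Matrix.one_mul]
      rw [h1]
      ext k l
      rw [Matrix.mul_apply]
      simp only [Matrix.transpose_apply, hUq, Matrix.one_apply, ite_mul, zero_mul, mul_ite,
        mul_zero, Finset.sum_ite_eq', Finset.mem_univ, if_true]
      by_cases hkl : k = l
      · subst hkl
        simp [← sq, hε]
      · rw [if_neg hkl]
        simp only [he.eq_iff, ite_eq_right_iff]
        exact fun h => absurd h.symm hkl
    · intro k
      rw [hq]
      exact div_pos (sub_pos.2 (hℓ k)) hs
  refine ⟨hqmem, fun p hp => ?_⟩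
  rw [objective_eq hσ hs.le hqmem U ℓ hS, objective_eq hσ hs.le hp U ℓ hS]
  refine add_le_add le_rfl ?_
  set g : Fin M → ℝ := fun j => componentLoss (σ ^ 2) (max (ℓ j) (σ ^ 2)) (ℓ j) with hg
  have h1 : ∑ k, componentLoss (σ ^ 2) (s * q.2 k + σ ^ 2) (∑ j, (Uᵀ * q.1) j k ^ 2 * ℓ j) =
      ∑ k, g (e k) := by
    refine Finset.sum_congr rfl fun k _ => ?_
    have e1 : ∑ j, (Uᵀ * q.1) j k ^ 2 * ℓ j = ℓ (e k) := by
      simp [hUq, hε]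
    have e2 : s * q.2 k + σ ^ 2 = ℓ (e k) := by
      rw [hq]
      field_simp
      ring
    simp only [hg]
    rw [e1, e2, max_eq_left (hℓ k).le]
  rw [h1]
  set w : Fin M → ℝ := fun j => ∑ k, (Uᵀ * p.1) j k ^ 2 with hw
  have hcol : ∀ k, ∑ j, (Uᵀ * p.1) j k ^ 2 = 1 := by
    intro k
    have h2 := sum_sq_transpose_mulVec_eq hU (p.1 *ᵥ Pi.single k 1)
    rw [dotProduct_mulVec_self_of_orthonormal hp.1] at h2
    have h3 : ∀ j, (Uᵀ *ᵥ (p.1 *ᵥ Pi.single k 1)) j = (Uᵀ * p.1) j k := by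
      intro j
      rw [Matrix.mulVec_mulVec, Matrix.mulVec_single_one]
      rfl
    simp only [h3] at h2
    rw [h2]
    simp
  have hrow : ∀ j, w j ≤ 1 := by
    intro j
    have h2 := sum_sq_transpose_mulVec_le hp.1 (U *ᵥ Pi.single j 1)
    rw [dotProduct_mulVec_self_of_orthonormal hU] at h2
    have h3 : ∀ k, (p.1ᵀ *ᵥ (U *ᵥ Pi.single j 1)) k = (Uᵀ * p.1) j k := by
      intro k
      rw [Matrix.mulVec_mulVec, ← Matrix.transpose_apply (Uᵀ * p.1), Matrix.transpose_mul,
        Matrix.transpose_transpose, Matrix.mulVec_single_one]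
      rfl
    simp only [h3] at h2
    refine h2.trans_eq ?_
    simp
  calc ∑ k, g (e k) ≤ ∑ j, w j * g j := by
        refine sum_le_sum_mul_of_extremal he
          (fun k j hj => componentLoss_min_antitone hσ2 (htop k j hj))
          (fun j => Finset.sum_nonneg fun _ _ => sq_nonneg _) hrow ?_
        rw [Finset.sum_comm]
        simp [hcol]
    _ = ∑ k, ∑ j, (Uᵀ * p.1) j k ^ 2 * g j := by
        rw [Finset.sum_comm]
        exact Finset.sum_congr rfl fun j _ => Finset.sum_mul _ _ _
    _ ≤ ∑ k, ∑ j, (Uᵀ * p.1) j k ^ 2 * componentLoss (σ ^ 2) (s * p.2 k + σ ^ 2) (ℓ j) := by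
        refine Finset.sum_le_sum fun k _ => Finset.sum_le_sum fun j _ =>
          mul_le_mul_of_nonneg_left (componentLoss_min hσ2 ?_) (sq_nonneg _)
        have := mul_pos hs (hp.2 k)
        linarith
    _ = _ := by
        refine Finset.sum_congr rfl fun k _ => ?_
        simp only [componentLoss, mul_sub, Finset.sum_sub_distrib, ← Finset.sum_mul, hcol, one_mul]
        rw [Finset.mul_sum]
        congr 1
        exact Finset.sum_congr rfl fun j _ => by ring

/-- The sample covariance matrix of the transformed data. -/
noncomputable def sampleCov {n m M : ℕ} (Φ : Matrix (Fin M) (Fin m) ℝ)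
    (y : Fin n → EuclideanSpace ℝ (Fin m)) : Matrix (Fin M) (Fin M) ℝ :=
  (n : ℝ)⁻¹ • ∑ i, Matrix.vecMulVec (Φ *ᵥ (y i).ofLp) (Φ *ᵥ (y i).ofLp)

lemma negLogLik_eq {n m M : ℕ} (Φ : Matrix (Fin M) (Fin m) ℝ)
    (y : Fin n → EuclideanSpace ℝ (Fin m)) (p : Matrix (Fin M) (Fin r) ℝ × (Fin r → ℝ)) :
    negLogLik Φ s σ y p = 1 / 2 * (((modelCov s σ p)⁻¹ * sampleCov Φ y).trace +
      Real.log (modelCov s σ p).det) := by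
  rw [negLogLik, sampleCov, Matrix.mul_smul, Matrix.trace_smul, smul_eq_mul]
  ring

lemma sampleCov_transpose {n m M : ℕ} (Φ : Matrix (Fin M) (Fin m) ℝ)
    (y : Fin n → EuclideanSpace ℝ (Fin m)) : (sampleCov Φ y)ᵀ = sampleCov Φ y := by
  simp [sampleCov, Matrix.transpose_sum, Matrix.transpose_vecMulVec]

lemma dotProduct_sampleCov_mulVec {n m M : ℕ} (Φ : Matrix (Fin M) (Fin m) ℝ)
    (y : Fin n → EuclideanSpace ℝ (Fin m)) (x : Fin M → ℝ) :
    x ⬝ᵥ sampleCov Φ y *ᵥ x = (n : ℝ)⁻¹ * ∑ i, ((Φᵀ *ᵥ x) ⬝ᵥ (y i).ofLp) ^ 2 := by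
  rw [sampleCov, Matrix.smul_mulVec, dotProduct_smul, smul_eq_mul, Matrix.sum_mulVec,
    dotProduct_sum]
  congr 1
  refine Finset.sum_congr rfl fun i _ => ?_
  rw [Matrix.vecMulVec_mulVec, ← dotProduct_mulVec_transpose, sq, dotProduct_comm _ x]
  simp

lemma isReml_of_top_eigenvectors {n m : ℕ} {Φ : Matrix (Fin M) (Fin m) ℝ}
    {y : Fin n → EuclideanSpace ℝ (Fin m)} (hσ : 0 < σ) (hs : 0 < s)
    {U : Matrix (Fin M) (Fin M) ℝ} (hU : Uᵀ * U = 1) {ℓ : Fin M → ℝ}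
    (hS : sampleCov Φ y = U * Matrix.diagonal ℓ * Uᵀ)
    {e : Fin r → Fin M} (he : Function.Injective e)
    (htop : ∀ k, ∀ j ∉ Set.range e, ℓ j ≤ ℓ (e k)) (hℓ : ∀ k, σ ^ 2 < ℓ (e k))
    {ε : Fin r → ℝ} (hε : ∀ k, ε k ^ 2 = 1) :
    IsReml Φ s σ y (Matrix.of fun i k => ε k * U i (e k), fun k => (ℓ (e k) - σ ^ 2) / s) := by
  obtain ⟨h1, h2⟩ := objective_le_of_top_eigenvectors hσ hs hU hS he htop hℓ hε rfl
  refine ⟨h1, fun p hp => ?_⟩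
  rw [Set.mem_ofPred_eq, negLogLik_eq, negLogLik_eq]
  have := h2 p hp
  linarith

end Likelihood

/-! ### Deterministic perturbation of eigenvectors and of the minimizer. -/

section Perturbation

variable {M r : ℕ} {s σ : ℝ} {θ : Matrix (Fin M) (Fin r) ℝ × (Fin r → ℝ)}

lemma modelCov_transpose (s σ : ℝ) (p : Matrix (Fin M) (Fin r) ℝ × (Fin r → ℝ)) :
    (modelCov s σ p)ᵀ = modelCov s σ p := by
  simp [modelCov, Matrix.transpose_mul, Matrix.mul_assoc]

lemma dotProduct_modelCov_mulVec (s σ : ℝ) (p : Matrix (Fin M) (Fin r) ℝ × (Fin r → ℝ))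
    (x y : Fin M → ℝ) :
    x ⬝ᵥ modelCov s σ p *ᵥ y =
      s * ∑ k, p.2 k * ((p.1ᵀ *ᵥ x) k * (p.1ᵀ *ᵥ y) k) + σ ^ 2 * (x ⬝ᵥ y) := by
  rw [modelCov, Matrix.add_mulVec, Matrix.smul_mulVec, Matrix.smul_mulVec, Matrix.one_mulVec,
    dotProduct_add, dotProduct_smul, dotProduct_smul, dotProduct_mul_diagonal_mul_transpose_mulVec,
    smul_eq_mul, smul_eq_mul]

lemma dotProduct_modelCov_mulVec_self_le (hs : 0 ≤ s) (hσs : σ ^ 2 ≤ s) (hθ : θ ∈ paramSpace M r)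
    {c : ℝ} (hc : 0 ≤ c) (hΛ : ∀ k, θ.2 k ≤ c) (x : Fin M → ℝ) :
    x ⬝ᵥ modelCov s σ θ *ᵥ x ≤ s * (c + 1) * (x ⬝ᵥ x) := by
  rw [dotProduct_modelCov_mulVec]
  have h1 : ∑ k, θ.2 k * ((θ.1ᵀ *ᵥ x) k * (θ.1ᵀ *ᵥ x) k) ≤ c * (x ⬝ᵥ x) := by
    refine le_trans ?_ (mul_le_mul_of_nonneg_left (sum_sq_transpose_mulVec_le hθ.1 x) hc)
    rw [Finset.mul_sum]
    refine Finset.sum_le_sum fun k _ => ?_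
    rw [← sq]
    exact mul_le_mul_of_nonneg_right (hΛ k) (sq_nonneg _)
  have h2 := mul_le_mul_of_nonneg_left h1 hs
  have h3 := mul_le_mul_of_nonneg_right hσs (dotProduct_self_nonneg' x)
  linarith

/-- Relative perturbation bounds for a unit eigenvector of a matrix close to the model
covariance, with the contributions of size `σ²` and `s` kept apart. -/
lemma eigenvector_perturbation (hσ : 0 < σ) (hσs : σ ^ 2 ≤ s) (hθ : θ ∈ paramSpace M r)
    {g c δ : ℝ} (hg : 0 < g) (hc : 0 ≤ c) (hΛg : ∀ k, g ≤ θ.2 k) (hΛc : ∀ k, θ.2 k ≤ c)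
    (hgap : ∀ k l, k ≠ l → g ≤ |θ.2 k - θ.2 l|) (hδ0 : 0 ≤ δ) (hδ1 : δ ≤ 1)
    (hδg : δ * (c + 1) ≤ g / 2) {S : Matrix (Fin M) (Fin M) ℝ} (hS : Sᵀ = S)
    (hSG : ∀ x, |x ⬝ᵥ (S - modelCov s σ θ) *ᵥ x| ≤ δ * (x ⬝ᵥ modelCov s σ θ *ᵥ x))
    {u : Fin M → ℝ} (huu : u ⬝ᵥ u = 1) {ℓ : ℝ} (hu : S *ᵥ u = ℓ • u) {k : Fin r}
    (hℓ : |ℓ - (s * θ.2 k + σ ^ 2)| ≤ δ * (s * θ.2 k + σ ^ 2)) (hsign : 0 ≤ (θ.1ᵀ *ᵥ u) k) :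
    (∀ l, l ≠ k → (θ.1ᵀ *ᵥ u) l ^ 2 ≤ (2 * (c + 1) / g * δ) ^ 2) ∧
    (u - θ.1 *ᵥ (θ.1ᵀ *ᵥ u)) ⬝ᵥ (u - θ.1 *ᵥ (θ.1ᵀ *ᵥ u)) ≤
      (2 * (c + 1) / g * δ) ^ 2 * (σ ^ 2 / s) ∧
    |(θ.1ᵀ *ᵥ u) k - 1| ≤ r * (2 * (c + 1) / g) ^ 2 * δ := by
  have hσ2 : 0 < σ ^ 2 := by positivity
  have hs : 0 < s := hσ2.trans_le hσs
  set D := 2 * (c + 1) / g with hD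
  have hD0 : 0 ≤ D := by positivity
  have hDg : D * g = 2 * (c + 1) := by rw [hD]; field_simp
  set a := θ.1ᵀ *ᵥ u with ha
  set w := u - θ.1 *ᵥ a with hw
  have hET : (S - modelCov s σ θ)ᵀ = S - modelCov s σ θ := by
    rw [Matrix.transpose_sub, hS, modelCov_transpose]
  have hCS := sq_dotProduct_mulVec_le hET (modelCov_transpose s σ θ) hSG
  have hGu : u ⬝ᵥ modelCov s σ θ *ᵥ u ≤ s * (c + 1) := by
    have := dotProduct_modelCov_mulVec_self_le (s := s) hs.le hσs hθ hc hΛc u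
    rwa [huu, mul_one] at this
  have hμc : ∀ l, s * θ.2 l + σ ^ 2 ≤ s * (c + 1) := fun l => by
    have := mul_le_mul_of_nonneg_left (hΛc l) hs.le
    linarith
  have hℓk : |ℓ - (s * θ.2 k + σ ^ 2)| ≤ s * (g / 2) := by
    refine hℓ.trans ((mul_le_mul_of_nonneg_left (hμc k) hδ0).trans ?_)
    have := mul_le_mul_of_nonneg_left hδg hs.le
    linarith
  have hEu : ∀ x, x ⬝ᵥ (S - modelCov s σ θ) *ᵥ u =
      ℓ * (x ⬝ᵥ u) - x ⬝ᵥ modelCov s σ θ *ᵥ u := by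
    intro x
    rw [Matrix.sub_mulVec, dotProduct_sub, hu, dotProduct_smul, smul_eq_mul]
  have hoff : ∀ l, l ≠ k → a l ^ 2 ≤ (D * δ) ^ 2 := by
    intro l hl
    set b := θ.1 *ᵥ Pi.single l 1 with hb
    have hBb : θ.1ᵀ *ᵥ b = Pi.single l 1 := by
      rw [hb, Matrix.mulVec_mulVec, hθ.1, Matrix.one_mulVec]
    have hbu : b ⬝ᵥ u = a l := by
      rw [dotProduct_comm, hb, dotProduct_mulVec_transpose, ← ha]
      simp
    have hGb : ∀ y, b ⬝ᵥ modelCov s σ θ *ᵥ y = s * (θ.2 l * (θ.1ᵀ *ᵥ y) l) + σ ^ 2 * (b ⬝ᵥ y) := by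
      intro y
      rw [dotProduct_modelCov_mulVec, hBb]
      simp [Pi.single_apply]
    have hbb : b ⬝ᵥ b = 1 := by
      rw [hb, dotProduct_mulVec_self_of_orthonormal hθ.1]; simp
    -- With `b` the `l`-th column of `B_*`, `bᵀ(S - Γ)u = (ℓ - μ_l) a_l`, where `μ_l = s Λ_l + σ²`;
    -- the gap makes `|ℓ - μ_l| ≥ s g / 2`.
    have h1 := hCS b u
    rw [hEu, hGb, hGb, hBb, hbu, hbb, ← ha, Pi.single_eq_same] at h1
    have h2 : (ℓ * a l - (s * (θ.2 l * a l) + σ ^ 2 * a l)) ^ 2 =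
      (ℓ - (s * θ.2 l + σ ^ 2)) ^ 2 * a l ^ 2 := by ring
    have h3 : s * (g / 2) ≤ |ℓ - (s * θ.2 l + σ ^ 2)| := by
      have h4 := mul_le_mul_of_nonneg_left (hgap k l hl.symm) hs.le
      have h5 : s * |θ.2 k - θ.2 l| = |(s * θ.2 k + σ ^ 2) - (s * θ.2 l + σ ^ 2)| := by
        rw [← abs_of_pos hs, ← abs_mul, abs_of_pos hs]
        congr 1; ring
      have h6 := abs_sub_le (s * θ.2 k + σ ^ 2) ℓ (s * θ.2 l + σ ^ 2)
      rw [abs_sub_comm _ ℓ] at h6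
      linarith
    have h4 : (s * (g / 2)) ^ 2 ≤ (ℓ - (s * θ.2 l + σ ^ 2)) ^ 2 := by
      rw [← sq_abs (ℓ - _)]
      exact pow_le_pow_left₀ (by positivity) h3 2
    have h5 : δ ^ 2 * (s * (θ.2 l * 1) + σ ^ 2 * 1) * (u ⬝ᵥ modelCov s σ θ *ᵥ u) ≤
        δ ^ 2 * (s * (c + 1)) * (s * (c + 1)) := by
      have hΓ0 : 0 ≤ s * (θ.2 l * 1) + σ ^ 2 * 1 := by
        have := mul_nonneg hs.le (hg.le.trans (hΛg l))
        linarith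
      calc _ ≤ δ ^ 2 * (s * (θ.2 l * 1) + σ ^ 2 * 1) * (s * (c + 1)) :=
            mul_le_mul_of_nonneg_left hGu (by positivity)
        _ ≤ _ := by
            refine mul_le_mul_of_nonneg_right (mul_le_mul_of_nonneg_left ?_ (sq_nonneg _))
              (by positivity)
            have := hμc l
            linarith
    have h6 : (s * (g / 2)) ^ 2 * a l ^ 2 ≤ δ ^ 2 * (s * (c + 1)) * (s * (c + 1)) := by
      have := mul_le_mul_of_nonneg_right h4 (sq_nonneg (a l))
      linarith
    have h7 : δ ^ 2 * (s * (c + 1)) * (s * (c + 1)) = (s * (g / 2)) ^ 2 * (D * δ) ^ 2 := by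
      have : c + 1 = D * g / 2 := by rw [hDg]; ring
      rw [this]; ring
    rw [h7] at h6
    exact le_of_mul_le_mul_left h6 (by positivity)
  have hBw : θ.1ᵀ *ᵥ w = 0 := by
    rw [hw, Matrix.mulVec_sub, Matrix.mulVec_mulVec, hθ.1, Matrix.one_mulVec, ← ha, sub_self]
  have hww : w ⬝ᵥ w = 1 - ∑ l, a l ^ 2 := by
    rw [hw, ha, dotProduct_sub_proj_self hθ.1, huu]
  have hwu : w ⬝ᵥ u = w ⬝ᵥ w := by
    have : w ⬝ᵥ w = w ⬝ᵥ u - w ⬝ᵥ (θ.1 *ᵥ a) := by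
      conv_lhs => rw [hw]
      rw [← hw, dotProduct_sub]
    rw [dotProduct_mulVec_transpose, hBw, zero_dotProduct, sub_zero] at this
    exact this.symm
  have hGw : ∀ y, w ⬝ᵥ modelCov s σ θ *ᵥ y = σ ^ 2 * (w ⬝ᵥ y) := by
    intro y
    rw [dotProduct_modelCov_mulVec, hBw]
    simp
  have hw0 := dotProduct_self_nonneg' w
  have hperp : w ⬝ᵥ w ≤ (D * δ) ^ 2 * (σ ^ 2 / s) := by
    rcases hw0.eq_or_lt with h0 | hpos
    · rw [← h0]; positivity
    -- The residual `w` is orthogonal to the columns of `B_*`, so `wᵀ Γ w = σ² |w|²`: this is the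
    -- source of the extra factor `σ²/s`.
    have h1 := hCS w u
    rw [hEu, hGw, hGw, hwu] at h1
    have h3 : s * (g / 2) ≤ ℓ - σ ^ 2 := by
      have h4 := mul_le_mul_of_nonneg_left (hΛg k) hs.le
      have h5 := (abs_le.1 hℓk).1
      linarith
    have h4 : (s * (g / 2)) ^ 2 ≤ (ℓ - σ ^ 2) ^ 2 := pow_le_pow_left₀ (by positivity) h3 2
    have h5 : δ ^ 2 * (σ ^ 2 * (w ⬝ᵥ w)) * (u ⬝ᵥ modelCov s σ θ *ᵥ u) ≤
        δ ^ 2 * (σ ^ 2 * (w ⬝ᵥ w)) * (s * (c + 1)) :=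
      mul_le_mul_of_nonneg_left hGu (by positivity)
    have h6 : (s * (g / 2)) ^ 2 * (w ⬝ᵥ w) ^ 2 ≤ δ ^ 2 * (σ ^ 2 * (w ⬝ᵥ w)) * (s * (c + 1)) := by
      have := mul_le_mul_of_nonneg_right h4 (sq_nonneg (w ⬝ᵥ w))
      linarith
    have h7 : ((s * (g / 2)) ^ 2 * (w ⬝ᵥ w)) * (w ⬝ᵥ w) ≤
        (δ ^ 2 * σ ^ 2 * (s * (c + 1))) * (w ⬝ᵥ w) := by linarith
    have h8 := le_of_mul_le_mul_right h7 hpos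
    have h9 : δ ^ 2 * σ ^ 2 * (s * (c + 1)) ≤ δ ^ 2 * σ ^ 2 * (s * (c + 1) ^ 2) :=
      mul_le_mul_of_nonneg_left (mul_le_mul_of_nonneg_left (by nlinarith) hs.le) (by positivity)
    have h10 : δ ^ 2 * σ ^ 2 * (s * (c + 1) ^ 2) =
        (s * (g / 2)) ^ 2 * ((D * δ) ^ 2 * (σ ^ 2 / s)) := by
      have : c + 1 = D * g / 2 := by rw [hDg]; ring
      rw [this]; field_simp
    rw [h10] at h9
    exact le_of_mul_le_mul_left (h8.trans h9) (by positivity)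
  refine ⟨hoff, hperp, ?_⟩
  have hsum : ∑ l, a l ^ 2 = a k ^ 2 + ∑ l ∈ Finset.univ.erase k, a l ^ 2 :=
    (Finset.add_sum_erase _ _ (Finset.mem_univ k)).symm
  have hrest : ∑ l ∈ Finset.univ.erase k, a l ^ 2 ≤ (r - 1) * (D * δ) ^ 2 := by
    refine (Finset.sum_le_sum fun l hl => hoff l (Finset.ne_of_mem_erase hl)).trans_eq ?_
    rw [Finset.sum_const, Finset.card_erase_of_mem (Finset.mem_univ k), Finset.card_univ,
      Fintype.card_fin, nsmul_eq_mul, Nat.cast_sub (by have := k.2; omega), Nat.cast_one]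
  have hrest0 : 0 ≤ ∑ l ∈ Finset.univ.erase k, a l ^ 2 := Finset.sum_nonneg fun _ _ => sq_nonneg _
  have hak1 : a k ≤ 1 := by
    have : a k ^ 2 ≤ 1 := by linarith
    exact (abs_le_of_sq_le_sq (by simpa using this) zero_le_one |> abs_le.1).2
  have hperp' : w ⬝ᵥ w ≤ (D * δ) ^ 2 := by
    refine hperp.trans (mul_le_of_le_one_right (sq_nonneg _) ?_)
    rwa [div_le_one hs]
  have hDδ : (D * δ) ^ 2 ≤ D ^ 2 * δ := by
    rw [mul_pow]
    exact mul_le_mul_of_nonneg_left (by nlinarith) (sq_nonneg _)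
  have hr : (r : ℝ) * (D * δ) ^ 2 ≤ r * (D ^ 2 * δ) :=
    mul_le_mul_of_nonneg_left hDδ (Nat.cast_nonneg _)
  -- As `0 ≤ a k ≤ 1`, `1 - a k ≤ 1 - a k ^ 2`, which is the mass of `u` on the other columns and on
  -- `w`. Sign normalization of `u` is essential here.
  rw [abs_sub_comm, abs_of_nonneg (by linarith)]
  nlinarith

lemma exists_perm_antitone (f : Fin r → ℝ) : ∃ π : Equiv.Perm (Fin r), Antitone (f ∘ π) := by
  refine ⟨Tuple.sort (-f), fun i j h => ?_⟩
  have := Tuple.monotone_sort (-f) h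
  simpa using this

/-- Deterministic consistency: if the sample covariance is relatively close to the model
covariance, there is a minimizer of the likelihood close to the parameter. -/
theorem exists_isReml_errorBounds {n m : ℕ} {Φ : Matrix (Fin M) (Fin m) ℝ}
    {y : Fin n → EuclideanSpace ℝ (Fin m)} (hrM : r ≤ M) (hσ : 0 < σ) (hσs : σ ^ 2 ≤ s)
    (hθ : θ ∈ paramSpace M r)
    {g c δ : ℝ} (hg : 0 < g) (hc : 0 ≤ c) (hΛg : ∀ k, g ≤ θ.2 k) (hΛc : ∀ k, θ.2 k ≤ c)
    (hgap : ∀ k l, k ≠ l → g ≤ |θ.2 k - θ.2 l|) (hδ0 : 0 ≤ δ) (hδ1 : δ < 1)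
    (hδg : δ * (c + 1) ≤ g / 2)
    (hSG : ∀ x, |x ⬝ᵥ (sampleCov Φ y - modelCov s σ θ) *ᵥ x| ≤
      δ * (x ⬝ᵥ modelCov s σ θ *ᵥ x)) :
    ∃ p, IsReml Φ s σ y p ∧ ErrorBounds s σ
      (r * (2 * (c + 1) / g + r * (2 * (c + 1) / g) ^ 2 + (c + 1)) * δ * (σ / √s)) p θ := by
  have hσ2 : 0 < σ ^ 2 := by positivity
  have hs : 0 < s := hσ2.trans_le hσs
  set S := sampleCov Φ y with hSdef
  have hST : Sᵀ = S := sampleCov_transpose Φ y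
  have hS0 : ∀ x, 0 ≤ x ⬝ᵥ S *ᵥ x := fun x => by
    rw [hSdef, dotProduct_sampleCov_mulVec]; positivity
  have hSpsd : S.PosSemidef := by
    refine Matrix.PosSemidef.of_dotProduct_mulVec_nonneg (isHermitian_of_transpose_eq hST) fun x => ?_
    simpa using hS0 x
  obtain ⟨U, hU, hSU⟩ := exists_sorted_diagonalization hSpsd.isHermitian
  set ℓ : Fin M → ℝ := fun j => sortedEigenvalue hSpsd.isHermitian j with hℓ
  have hℓanti : Antitone ℓ := fun i j h => sortedEigenvalue_antitoneOn _ h j.2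
  have hℓ0 : ∀ j, 0 ≤ ℓ j := fun j => sortedEigenvalue_nonneg hSpsd j
  -- The entries of `Λ_*` come in arbitrary order; sorting them allows comparison with the ordered
  -- eigenvalues of `S`.
  obtain ⟨π, hπ⟩ := exists_perm_antitone θ.2
  set B' := θ.1.submatrix id π with hB'
  have hB'B' : B'ᵀ * B' = 1 := by
    rw [hB', Matrix.transpose_submatrix, ← Matrix.submatrix_mul _ _ _ _ _ Function.bijective_id,
      hθ.1]
    simp
  have hB'x : ∀ x k, (B'ᵀ *ᵥ x) k = (θ.1ᵀ *ᵥ x) (π k) := fun x k => rfl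
  have hform : ∀ x, ∑ k, s * θ.2 (π k) * (B'ᵀ *ᵥ x) k ^ 2 =
      x ⬝ᵥ modelCov s σ θ *ᵥ x - σ ^ 2 * (x ⬝ᵥ x) := by
    intro x
    rw [dotProduct_modelCov_mulVec, add_sub_cancel_right, Finset.mul_sum]
    simp only [hB'x]
    rw [Equiv.sum_comp π fun k => s * θ.2 k * (θ.1ᵀ *ᵥ x) k ^ 2]
    exact Finset.sum_congr rfl fun k _ => by ring
  have hformS : ∀ x, ∑ k, ℓ k * (Uᵀ *ᵥ x) k ^ 2 = x ⬝ᵥ S *ᵥ x := by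
    intro x
    conv_rhs => rw [hSU, dotProduct_mul_diagonal_mul_transpose_mulVec]
    exact Finset.sum_congr rfl fun k _ => by rw [sq]
  have hSG' : ∀ x, |x ⬝ᵥ S *ᵥ x - x ⬝ᵥ modelCov s σ θ *ᵥ x| ≤
      δ * (x ⬝ᵥ modelCov s σ θ *ᵥ x) := by
    intro x
    have := hSG x
    rwa [Matrix.sub_mulVec, dotProduct_sub] at this
  have hb0 : ∀ k, 0 ≤ s * θ.2 (π k) := fun k => mul_nonneg hs.le (hg.le.trans (hΛg _))
  have hbanti : Antitone fun k => s * θ.2 (π k) := fun i j h =>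
    mul_le_mul_of_nonneg_left (hπ h) hs.le
  have h1δ : 0 < 1 - δ := by linarith
  -- Weyl's comparison is applied to the rank-`r` part `Γ - σ² I`, the shift by `σ²` being carried
  -- by `γ`.
  have hlow : ∀ k : Fin r, (1 - δ) * (s * θ.2 (π k) + σ ^ 2) ≤ ℓ (Fin.castLE hrM k) := by
    intro k
    have := eigenvalue_le_of_form_le hB'B' hU hbanti hℓanti hℓ0 (β := (1 - δ)⁻¹)
      (γ := -σ ^ 2) (by positivity) (fun x => by
        rw [hform, hformS]
        have h1 := (abs_le.1 (hSG' x)).1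
        have h2 : x ⬝ᵥ modelCov s σ θ *ᵥ x ≤ (1 - δ)⁻¹ * (x ⬝ᵥ S *ᵥ x) := by
          rw [← div_eq_inv_mul, le_div_iff₀ h1δ]; linarith
        linarith) k.2 (k.2.trans_le hrM)
    have h3 : s * θ.2 (π k) + σ ^ 2 ≤ (1 - δ)⁻¹ * ℓ (Fin.castLE hrM k) := by
      have : s * θ.2 (π k) ≤ (1 - δ)⁻¹ * ℓ (Fin.castLE hrM k) + -σ ^ 2 := this
      linarith
    rw [← div_eq_inv_mul, le_div_iff₀ h1δ] at h3
    linarith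
  have hupp : ∀ k : Fin r, ℓ (Fin.castLE hrM k) ≤ (1 + δ) * (s * θ.2 (π k) + σ ^ 2) := by
    intro k
    have := eigenvalue_le_of_form_le hU hB'B' hℓanti hbanti hb0 (β := 1 + δ)
      (γ := (1 + δ) * σ ^ 2) (by positivity) (fun x => by
        rw [hform, hformS]
        have h1 := (abs_le.1 (hSG' x)).2
        linarith) (k.2.trans_le hrM) k.2
    have : ℓ (Fin.castLE hrM k) ≤ (1 + δ) * (s * θ.2 (π k)) + (1 + δ) * σ ^ 2 := this
    linarith
  set e : Fin r → Fin M := fun k => Fin.castLE hrM (π.symm k) with he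
  have hℓe : ∀ k, |ℓ (e k) - (s * θ.2 k + σ ^ 2)| ≤ δ * (s * θ.2 k + σ ^ 2) := by
    intro k
    have h1 := hlow (π.symm k)
    have h2 := hupp (π.symm k)
    rw [Equiv.apply_symm_apply] at h1 h2
    rw [abs_le]
    constructor <;> simp only [e] <;> linarith
  have heinj : Function.Injective e := (Fin.castLE_injective hrM).comp π.symm.injective
  have htop : ∀ k, ∀ j ∉ Set.range e, ℓ j ≤ ℓ (e k) := by
    intro k j hj
    apply hℓanti
    rw [Fin.le_def]
    by_contra hlt
    have hjr : (j : ℕ) < r := (not_le.1 hlt).trans (π.symm k).2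
    exact hj ⟨π ⟨j, hjr⟩, by simp [e]⟩
  have hμc : ∀ l, s * θ.2 l + σ ^ 2 ≤ s * (c + 1) := fun l => by
    have := mul_le_mul_of_nonneg_left (hΛc l) hs.le
    linarith
  have hℓs : ∀ k, |ℓ (e k) - (s * θ.2 k + σ ^ 2)| ≤ s * (δ * (c + 1)) := fun k =>
    (hℓe k).trans ((mul_le_mul_of_nonneg_left (hμc k) hδ0).trans_eq (by ring))
  have hℓσ : ∀ k, σ ^ 2 < ℓ (e k) := by
    intro k
    have h1 := (abs_le.1 (hℓs k)).1
    have h2 := mul_le_mul_of_nonneg_left hδg hs.le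
    have h3 := mul_le_mul_of_nonneg_left (hΛg k) hs.le
    have := mul_pos hs hg
    linarith
  -- Among the minimizers differing by column signs, take the one positively aligned with `B_*`.
  set ε : Fin r → ℝ := fun k => if 0 ≤ (θ.1ᵀ *ᵥ (U *ᵥ Pi.single (e k) 1)) k then 1 else -1 with hε
  have hε2 : ∀ k, ε k ^ 2 = 1 := fun k => by
    simp only [ε]; split_ifs <;> norm_num
  set p : Matrix (Fin M) (Fin r) ℝ × (Fin r → ℝ) :=
    (Matrix.of fun i k => ε k * U i (e k), fun k => (ℓ (e k) - σ ^ 2) / s) with hp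
  refine ⟨p, isReml_of_top_eigenvectors hσ hs hU hSU heinj htop hℓσ hε2, ?_⟩
  set u : Fin r → Fin M → ℝ := fun k => p.1 *ᵥ Pi.single k 1 with hu
  have huU : ∀ k, u k = ε k • (U *ᵥ Pi.single (e k) 1) := by
    intro k
    ext i
    simp [u, p]
  have huu : ∀ k, u k ⬝ᵥ u k = 1 := by
    intro k
    rw [huU, smul_dotProduct, dotProduct_smul, dotProduct_mulVec_self_of_orthonormal hU]
    simp [← sq, hε2]
  have hSu : ∀ k, S *ᵥ u k = ℓ (e k) • u k := by
    intro k
    rw [huU, Matrix.mulVec_smul, smul_comm]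
    congr 1
    conv_lhs => rw [hSU]
    rw [Matrix.mulVec_mulVec, Matrix.mul_assoc, hU, Matrix.mul_one,
      ← Matrix.mulVec_mulVec, Matrix.diagonal_mulVec_single, ← Matrix.mulVec_smul, mul_one]
    congr 1
    ext i; simp [Pi.single_apply]
  have hsign : ∀ k, 0 ≤ (θ.1ᵀ *ᵥ u k) k := by
    intro k
    rw [huU, Matrix.mulVec_smul, Pi.smul_apply, smul_eq_mul]
    simp only [ε]
    split_ifs with h
    · linarith
    · linarith
  have hpert := fun k => eigenvector_perturbation hσ hσs hθ hg hc hΛg hΛc hgap hδ0 hδ1.le hδg hST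
    hSG (huu k) (hSu k) (hℓe k) (hsign k)
  set D := 2 * (c + 1) / g with hD
  have hD0 : 0 ≤ D := by positivity
  have hr0 : (0 : ℝ) ≤ r := Nat.cast_nonneg r
  have hrr : (r : ℝ) ≤ r ^ 2 := by exact_mod_cast Nat.le_self_pow two_ne_zero r
  have hentry : ∀ {q : ℕ} (N : Matrix (Fin q) (Fin M) ℝ) (l : Fin q) (k : Fin r),
      (N * p.1) l k = (N *ᵥ u k) l := by
    intro q N l k
    rw [hu, Matrix.mulVec_mulVec, Matrix.mulVec_single_one]
    rfl
  have hscale : √(s / σ ^ 2) * (r * (D + r * D ^ 2 + (c + 1)) * δ * (σ / √s)) =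
      r * (D + r * D ^ 2 + (c + 1)) * δ := by
    rw [Real.sqrt_div hs.le, Real.sqrt_sq hσ.le]
    have := Real.sqrt_pos.2 hs
    field_simp
  refine ⟨?_, ?_, ?_⟩
  · have h1 : (1 - θ.1 * θ.1ᵀ) * (p.1 - θ.1) = (1 - θ.1 * θ.1ᵀ) * p.1 := by
      rw [Matrix.mul_sub, Matrix.sub_mul _ _ θ.1, Matrix.one_mul, Matrix.mul_assoc θ.1, hθ.1,
        Matrix.mul_one, sub_self, sub_zero]
    rw [h1]
    have h2 : ‖(1 - θ.1 * θ.1ᵀ) * p.1‖ ^ 2 ≤ r * ((D * δ) ^ 2 * (σ ^ 2 / s)) := by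
      rw [frobenius_norm_sq, Finset.sum_comm]
      calc _ ≤ ∑ _k : Fin r, (D * δ) ^ 2 * (σ ^ 2 / s) := by
            refine Finset.sum_le_sum fun k _ => ?_
            refine le_trans (le_of_eq ?_) (hpert k).2.1
            rw [dotProduct_self_eq_sum_sq]
            refine Finset.sum_congr rfl fun i _ => ?_
            rw [hentry, Matrix.sub_mulVec, Matrix.one_mulVec, ← Matrix.mulVec_mulVec]
        _ = _ := by simp
    have h3 : r * ((D * δ) ^ 2 * (σ ^ 2 / s)) ≤ (r * D * δ * (σ / √s)) ^ 2 := by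
      have : (r * D * δ * (σ / √s)) ^ 2 = r ^ 2 * ((D * δ) ^ 2 * (σ ^ 2 / s)) := by
        rw [mul_pow _ (σ / √s), div_pow, Real.sq_sqrt hs.le]; ring
      rw [this]
      exact mul_le_mul_of_nonneg_right hrr (by positivity)
    refine ((sq_le_sq₀ (norm_nonneg _) (by positivity)).1 (h2.trans h3)).trans ?_
    refine mul_le_mul_of_nonneg_right (mul_le_mul_of_nonneg_right (mul_le_mul_of_nonneg_left ?_ hr0)
      hδ0) (by positivity)
    have : 0 ≤ r * D ^ 2 := by positivity
    linarith
  · rw [hscale]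
    have h2 : ‖θ.1ᵀ * (p.1 - θ.1)‖ ^ 2 ≤ (r * ((D + r * D ^ 2) * δ)) ^ 2 := by
      rw [frobenius_norm_sq]
      calc _ ≤ ∑ _l : Fin r, ∑ _k : Fin r, ((D + r * D ^ 2) * δ) ^ 2 := by
            refine Finset.sum_le_sum fun l _ => Finset.sum_le_sum fun k _ => ?_
            rw [Matrix.mul_sub, hθ.1, Matrix.sub_apply, hentry, ← sq_abs]
            refine pow_le_pow_left₀ (abs_nonneg _) ?_ 2
            by_cases hlk : l = k
            · subst hlk
              rw [Matrix.one_apply_eq]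
              refine (hpert l).2.2.trans ?_
              have : 0 ≤ D * δ := by positivity
              linarith
            · rw [Matrix.one_apply_ne hlk, sub_zero]
              refine (abs_le_of_sq_le_sq ((hpert k).1 l hlk) (by positivity)).trans ?_
              have : 0 ≤ r * D ^ 2 * δ := by positivity
              linarith
        _ = _ := by simp; ring
    refine ((sq_le_sq₀ (norm_nonneg _) (by positivity)).1 h2).trans ?_
    have : 0 ≤ r * ((c + 1) * δ) := by positivity
    linarith
  · rw [hscale]
    have h2 : ‖Matrix.diagonal p.2 - Matrix.diagonal θ.2‖ ^ 2 ≤ (r * ((c + 1) * δ)) ^ 2 := by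
      rw [Matrix.diagonal_sub, frobenius_norm_sq]
      calc _ ≤ ∑ _l : Fin r, ∑ _k : Fin r, ((c + 1) * δ) ^ 2 := by
            refine Finset.sum_le_sum fun l _ => Finset.sum_le_sum fun k _ => ?_
            by_cases hlk : l = k
            · subst hlk
              rw [Matrix.diagonal_apply_eq, ← sq_abs]
              refine pow_le_pow_left₀ (abs_nonneg _) ?_ 2
              have e1 : p.2 l - θ.2 l = (ℓ (e l) - (s * θ.2 l + σ ^ 2)) / s := by
                simp only [p]; field_simp; ring
              rw [e1, abs_div, abs_of_pos hs, div_le_iff₀ hs]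
              refine (hℓs l).trans_eq (by ring)
            · rw [Matrix.diagonal_apply_ne _ hlk, sq (0 : ℝ), zero_mul]
              exact sq_nonneg _
        _ = _ := by simp; ring
    refine ((sq_le_sq₀ (norm_nonneg _) (by positivity)).1 h2).trans ?_
    have : 0 ≤ r * ((D + r * D ^ 2) * δ) := by positivity
    linarith

end Perturbation

/-! ### Uniform concentration of the sample covariance. -/

section Concentration

lemma exists_whitening {M : ℕ} {A : Matrix (Fin M) (Fin M) ℝ} (hA : Aᵀ = A)
    (hpos : ∀ x, x ≠ 0 → 0 < x ⬝ᵥ A *ᵥ x) :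
    ∃ Q R : Matrix (Fin M) (Fin M) ℝ, Q * R = 1 ∧ Qᵀ * A * Q = 1 := by
  obtain ⟨U, hU, hAU⟩ := exists_sorted_diagonalization (isHermitian_of_transpose_eq hA)
  set ℓ : Fin M → ℝ := fun j => sortedEigenvalue (isHermitian_of_transpose_eq hA) j
  have hUU : U * Uᵀ = 1 := mul_eq_one_comm.1 hU
  have hUAU : Uᵀ * A * U = Matrix.diagonal ℓ := by
    calc Uᵀ * A * U = (Uᵀ * U) * Matrix.diagonal ℓ * (Uᵀ * U) := by
          conv_lhs => rw [hAU]
          simp only [Matrix.mul_assoc]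
      _ = _ := by rw [hU, Matrix.one_mul, Matrix.mul_one]
  have hℓ : ∀ j, 0 < ℓ j := by
    intro j
    have h1 := hpos (U *ᵥ Pi.single j 1) (fun h0 => by
      have := dotProduct_mulVec_self_of_orthonormal hU (Pi.single j 1) (Pi.single j 1)
      rw [h0] at this
      simp at this)
    have h2 : (U *ᵥ Pi.single j 1) ⬝ᵥ A *ᵥ (U *ᵥ Pi.single j 1) = ℓ j := by
      rw [dotProduct_comm, dotProduct_mulVec_transpose, Matrix.mulVec_mulVec, Matrix.mulVec_mulVec,
        hUAU]
      simp
    rwa [h2] at h1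
  refine ⟨U * Matrix.diagonal fun j => (√(ℓ j))⁻¹, (Matrix.diagonal fun j => √(ℓ j)) * Uᵀ, ?_, ?_⟩
  · rw [Matrix.mul_assoc, ← Matrix.mul_assoc (Matrix.diagonal _), Matrix.diagonal_mul_diagonal]
    have : (fun j => (√(ℓ j))⁻¹ * √(ℓ j)) = 1 := by
      ext j
      exact inv_mul_cancel₀ (Real.sqrt_pos.2 (hℓ j)).ne'
    rw [this]
    simpa using hUU
  · rw [Matrix.transpose_mul, Matrix.diagonal_transpose]
    have e : (Matrix.diagonal fun j => (√(ℓ j))⁻¹) * Uᵀ * A * (U * Matrix.diagonal fun j => (√(ℓ j))⁻¹) =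
        (Matrix.diagonal fun j => (√(ℓ j))⁻¹) * (Uᵀ * A * U) *
          Matrix.diagonal fun j => (√(ℓ j))⁻¹ := by
      simp only [Matrix.mul_assoc]
    rw [e, hUAU, Matrix.diagonal_mul_diagonal, Matrix.diagonal_mul_diagonal, ← Matrix.diagonal_one]
    congr 1
    ext j
    have h := Real.sqrt_pos.2 (hℓ j)
    have h2 := Real.mul_self_sqrt (hℓ j).le
    field_simp
    linarith

/-- Relative concentration of the sample covariance matrix, uniformly over all directions. -/
lemma measureReal_sampleCov_deviation_le {Ω : Type*} [MeasurableSpace Ω] {P : Measure Ω}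
    [IsProbabilityMeasure P] {n m M : ℕ} (hn : 0 < n) (hM : 0 < M)
    {Φ : Matrix (Fin M) (Fin m) ℝ} {S : Matrix (Fin m) (Fin m) ℝ} (hS : S.PosSemidef)
    (hpos : ∀ x, x ≠ 0 → 0 < x ⬝ᵥ (Φ * S * Φᵀ) *ᵥ x) {Y : Fin n → Ω → EuclideanSpace ℝ (Fin m)}
    (hY : ∀ i, HasLaw (Y i) (multivariateGaussian 0 S) P) (hind : iIndepFun Y P)
    {δ : ℝ} (hδ0 : 0 ≤ δ) (hδ1 : δ ≤ 1) :
    P.real {ω | ¬ ∀ x : Fin M → ℝ, |x ⬝ᵥ (sampleCov Φ (fun i => Y i ω) - Φ * S * Φᵀ) *ᵥ x| ≤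
      4 * δ * (x ⬝ᵥ (Φ * S * Φᵀ) *ᵥ x)} ≤
      (8 * M + 1 : ℝ) ^ M * (2 * Real.exp (-(n * δ ^ 2 / 16))) := by
  have hST : Sᵀ = S := hS.isHermitian
  have hAT : (Φ * S * Φᵀ)ᵀ = Φ * S * Φᵀ := by
    rw [Matrix.transpose_mul, Matrix.transpose_mul, Matrix.transpose_transpose, hST,
      Matrix.mul_assoc]
  obtain ⟨Q, R, hQR, hQ⟩ := exists_whitening hAT hpos
  have hnr : (0 : ℝ) < n := by exact_mod_cast hn
  set F := Fintype.piFinset fun _ : Fin M => Finset.Icc (-(4 * M : ℤ)) (4 * M) with hF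
  let zr : (Fin M → ℤ) → Fin M → ℝ := fun z i => z i
  let X : (Fin M → ℤ) → Fin n → Ω → ℝ := fun z i ω => (Φᵀ *ᵥ (Q *ᵥ zr z)) ⬝ᵥ (Y i ω).ofLp
  let bad : (Fin M → ℤ) → Set Ω := fun z =>
    {ω | ¬ |(zr z) ⬝ᵥ (Qᵀ * sampleCov Φ (fun i => Y i ω) * Q - 1) *ᵥ (zr z)| ≤
      δ * (zr z ⬝ᵥ zr z)}
  have hconj : ∀ (N : Matrix (Fin M) (Fin M) ℝ) (z : Fin M → ℝ),
      z ⬝ᵥ (Qᵀ * N * Q) *ᵥ z = (Q *ᵥ z) ⬝ᵥ N *ᵥ (Q *ᵥ z) := by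
    intro N z
    rw [Matrix.mul_assoc, ← Matrix.mulVec_mulVec, dotProduct_mulVec_transpose,
      Matrix.transpose_transpose, Matrix.mulVec_mulVec]
  have hsub : {ω | ¬ ∀ x : Fin M → ℝ, |x ⬝ᵥ (sampleCov Φ (fun i => Y i ω) - Φ * S * Φᵀ) *ᵥ x| ≤
      4 * δ * (x ⬝ᵥ (Φ * S * Φᵀ) *ᵥ x)} ⊆ ⋃ z ∈ F, bad z := by
    intro ω hω
    by_contra hno
    simp only [Set.mem_iUnion, not_exists, bad, Set.mem_ofPred_eq, not_not] at hno
    refine hω fun x => ?_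
    have hT : (Qᵀ * sampleCov Φ (fun i => Y i ω) * Q - 1)ᵀ =
        Qᵀ * sampleCov Φ (fun i => Y i ω) * Q - 1 := by
      simp [Matrix.transpose_mul, sampleCov_transpose, Matrix.mul_assoc]
    have h1 := abs_form_le_of_lattice hT hδ0 hM hno (R *ᵥ x)
    have h2 : Qᵀ * sampleCov Φ (fun i => Y i ω) * Q - 1 =
        Qᵀ * (sampleCov Φ (fun i => Y i ω) - Φ * S * Φᵀ) * Q := by
      rw [Matrix.mul_sub, Matrix.sub_mul, hQ]
    have h3 : Q *ᵥ (R *ᵥ x) = x := by rw [Matrix.mulVec_mulVec, hQR, Matrix.one_mulVec]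
    have h4 : (R *ᵥ x) ⬝ᵥ (R *ᵥ x) = x ⬝ᵥ (Φ * S * Φᵀ) *ᵥ x := by
      have := hconj (Φ * S * Φᵀ) (R *ᵥ x)
      rwa [hQ, Matrix.one_mulVec, h3] at this
    rwa [h2, hconj, h3, h4] at h1
  have hbad : ∀ z ∈ F, P.real (bad z) ≤ 2 * Real.exp (-(n * δ ^ 2 / 16)) := by
    intro z _
    -- At `z = 0` the variance vanishes and the Gaussian bound does not apply, but the event is
    -- empty.
    by_cases hz : zr z = 0
    · have : bad z = ∅ := by
        ext ω
        simp [bad, hz]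
      rw [this, measureReal_empty]
      positivity
    -- Whitening makes the variance of the scalar sample in direction `z` equal to `|z|²`, so the
    -- scalar bound is already relative.
    have hvar : (Φᵀ *ᵥ (Q *ᵥ zr z)) ⬝ᵥ S *ᵥ (Φᵀ *ᵥ (Q *ᵥ zr z)) = zr z ⬝ᵥ zr z := by
      have h1 := hconj (Φ * S * Φᵀ) (zr z)
      rw [hQ, Matrix.one_mulVec] at h1
      rw [h1, Matrix.mul_assoc, ← Matrix.mulVec_mulVec, dotProduct_mulVec_transpose Φ,
        ← Matrix.mulVec_mulVec]
    have hzpos : 0 < zr z ⬝ᵥ zr z := by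
      refine (dotProduct_self_nonneg' _).lt_of_ne fun h => hz ?_
      exact dotProduct_self_eq_zero.1 h.symm
    have hX : ∀ i, HasLaw (X z i) (gaussianReal 0 (zr z ⬝ᵥ zr z).toNNReal) P := fun i => by
      rw [← hvar]
      exact hasLaw_dotProduct_gaussian hS (hY i) _
    have hXind : iIndepFun (X z) P :=
      hind.comp (fun _ y => (Φᵀ *ᵥ (Q *ᵥ zr z)) ⬝ᵥ y.ofLp) (fun _ => by
        simp only [dotProduct]; fun_prop)
    have h1 := measureReal_abs_sum_sq_sub_ge_le (Real.toNNReal_pos.2 hzpos).ne' hX hXind hδ0 hδ1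
    rw [Real.coe_toNNReal _ hzpos.le] at h1
    refine (measureReal_mono ?_ (measure_ne_top _ _)).trans h1
    intro ω hω
    have hω' := not_le.1 hω
    have h2 : n * (zr z ⬝ᵥ (Qᵀ * sampleCov Φ (fun i => Y i ω) * Q - 1) *ᵥ zr z) =
        ∑ i, X z i ω ^ 2 - n * (zr z ⬝ᵥ zr z) := by
      rw [Matrix.sub_mulVec, dotProduct_sub, hconj, dotProduct_sampleCov_mulVec, Matrix.one_mulVec,
        mul_sub, mul_inv_cancel_left₀ hnr.ne']
    rw [Set.mem_ofPred_eq, ← h2, abs_mul, abs_of_pos hnr]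
    exact mul_le_mul_of_nonneg_left hω'.le hnr.le
  calc _ ≤ P.real (⋃ z ∈ F, bad z) := measureReal_mono hsub (measure_ne_top _ _)
    _ ≤ ∑ z ∈ F, P.real (bad z) := measureReal_biUnion_finset_le _ _
    _ ≤ ∑ z ∈ F, 2 * Real.exp (-(n * δ ^ 2 / 16)) := Finset.sum_le_sum hbad
    _ = _ := by
      rw [Finset.sum_const, nsmul_eq_mul, hF, Fintype.card_piFinset_const, Int.card_Icc]
      congr 1
      have : ((4 * M + 1 - -(4 * M) : ℤ)).toNat = 8 * M + 1 := by omega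
      rw [this]
      push_cast
      rfl

end Concentration

/-! ### Transfer of the spectral gaps to the target parameter. -/

section Parameters

variable {m M r : ℕ} {s c₁ c₂ : ℝ} {A : Matrix (Fin m) (Fin m) ℝ}

/-- Replacing `c₂` by `|c₂| + 1` gives a positive lower bound without assuming a sign for `c₂`. -/
lemma EigenvalueCondition.inv_le_gap (h : EigenvalueCondition A s r c₁ c₂) {j : ℕ} (hj : j < r) :
    (|c₂| + 1)⁻¹ ≤ sortedEigenvalue h.posSemidef.isHermitian j / s -
      sortedEigenvalue h.posSemidef.isHermitian (j + 1) / s := by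
  have h1 := h.gap j hj
  have h2 := sub_pos.2 (h.strictly_decreasing j hj)
  rw [inv_le_comm₀ (by positivity) h2]
  linarith [le_abs_self c₂]

/-- The eigenvalue condition passes to any model covariance close to the true one. -/
lemma EigenvalueCondition.param_bounds (h : EigenvalueCondition A s r c₁ c₂) (hs : 0 < s)
    (hrm : r ≤ m) {Φ : Matrix (Fin M) (Fin m) ℝ} (hΦ : Φ * Φᵀ = 1)
    {θ : Matrix (Fin M) (Fin r) ℝ × (Fin r → ℝ)} (hθ : θ ∈ paramSpace M r) {κ : ℝ}
    (hA : ‖A - s • (Φᵀ * θ.1 * Matrix.diagonal θ.2 * θ.1ᵀ * Φ)‖ ≤ s * κ) :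
    (∀ k, θ.2 k ≤ c₁ + κ) ∧ (∀ k, (|c₂| + 1)⁻¹ - κ ≤ θ.2 k) ∧
      ∀ k l, k ≠ l → (|c₂| + 1)⁻¹ - 2 * κ ≤ |θ.2 k - θ.2 l| := by
  obtain ⟨π, hπ⟩ := exists_perm_antitone θ.2
  set L : ℕ → ℝ := fun j => sortedEigenvalue h.posSemidef.isHermitian j / s with hL
  have hLs : ∀ j, sortedEigenvalue h.posSemidef.isHermitian j = s * L j := fun j => by
    simp only [L]; field_simp
  have hL0 : ∀ j, 0 ≤ L j := fun j => div_nonneg (sortedEigenvalue_nonneg h.posSemidef _) hs.le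
  have hLanti : ∀ {i j : ℕ}, i ≤ j → j < m → L j ≤ L i := fun hij hj =>
    div_le_div_of_nonneg_right (sortedEigenvalue_antitoneOn h.posSemidef.isHermitian hij hj) hs.le
  obtain ⟨U, hU, hAU⟩ := exists_sorted_diagonalization h.posSemidef.isHermitian
  set V := Φᵀ * θ.1.submatrix id π with hV
  have hVV : Vᵀ * V = 1 := by
    rw [hV, Matrix.transpose_mul, Matrix.transpose_transpose, Matrix.mul_assoc,
      ← Matrix.mul_assoc Φ, hΦ, Matrix.one_mul, Matrix.transpose_submatrix,
      ← Matrix.submatrix_mul _ _ _ _ _ Function.bijective_id, hθ.1]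
    simp
  set N := s • (Φᵀ * θ.1 * Matrix.diagonal θ.2 * θ.1ᵀ * Φ) with hN
  have hformN : ∀ x, ∑ k, s * θ.2 (π k) * (Vᵀ *ᵥ x) k ^ 2 = x ⬝ᵥ N *ᵥ x := by
    intro x
    have e : Φᵀ * θ.1 * Matrix.diagonal θ.2 * θ.1ᵀ * Φ =
        (Φᵀ * θ.1) * Matrix.diagonal θ.2 * (Φᵀ * θ.1)ᵀ := by
      rw [Matrix.transpose_mul, Matrix.transpose_transpose]
      simp only [Matrix.mul_assoc]
    rw [hN, Matrix.smul_mulVec, dotProduct_smul, smul_eq_mul, e,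
      dotProduct_mul_diagonal_mul_transpose_mulVec, Finset.mul_sum]
    have hVx : ∀ k, (Vᵀ *ᵥ x) k = ((Φᵀ * θ.1)ᵀ *ᵥ x) (π k) := fun k => rfl
    simp only [hVx]
    rw [Equiv.sum_comp π fun k => s * θ.2 k * ((Φᵀ * θ.1)ᵀ *ᵥ x) k ^ 2]
    exact Finset.sum_congr rfl fun k _ => by ring
  have hformA : ∀ x, ∑ k : Fin m, s * L k * (Uᵀ *ᵥ x) k ^ 2 = x ⬝ᵥ A *ᵥ x := by
    intro x
    conv_rhs => rw [hAU, dotProduct_mul_diagonal_mul_transpose_mulVec]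
    exact Finset.sum_congr rfl fun k _ => by rw [sq, hLs]
  have hdiff : ∀ x, |x ⬝ᵥ A *ᵥ x - x ⬝ᵥ N *ᵥ x| ≤ s * κ * (x ⬝ᵥ x) := by
    intro x
    rw [← dotProduct_sub, ← Matrix.sub_mulVec]
    exact (abs_dotProduct_mulVec_le_frobenius _ x).trans
      (mul_le_mul_of_nonneg_right hA (dotProduct_self_nonneg' x))
  have hanti1 : Antitone fun k => s * θ.2 (π k) := fun i j hij =>
    mul_le_mul_of_nonneg_left (hπ hij) hs.le
  have hanti2 : Antitone fun k : Fin m => s * L k := fun i j hij =>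
    mul_le_mul_of_nonneg_left (hLanti hij j.2) hs.le
  have hlow : ∀ k : Fin r, θ.2 (π k) ≤ L k + κ := by
    intro k
    have h1 : s * θ.2 (π k) ≤ 1 * (s * L k) + s * κ :=
      eigenvalue_le_of_form_le hVV hU hanti1 hanti2
        (fun i => mul_nonneg hs.le (hL0 i)) zero_le_one (fun x => by
          rw [hformN, hformA]
          have := (abs_le.1 (hdiff x)).1
          linarith) k.2 (k.2.trans_le hrm)
    exact le_of_mul_le_mul_left (by linarith) hs
  have hupp : ∀ k : Fin r, L k ≤ θ.2 (π k) + κ := by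
    intro k
    have h1 : s * L k ≤ 1 * (s * θ.2 (π k)) + s * κ :=
      eigenvalue_le_of_form_le hU hVV hanti2 hanti1
        (fun i => mul_nonneg hs.le (hθ.2 _).le) zero_le_one (fun x => by
          rw [hformN, hformA]
          have := (abs_le.1 (hdiff x)).2
          linarith) (k.2.trans_le hrm) k.2
    exact le_of_mul_le_mul_left (by linarith) hs
  have hgapL : ∀ j < r, (|c₂| + 1)⁻¹ ≤ L j - L (j + 1) := fun j hj => h.inv_le_gap hj
  have hlt : ∀ i j : Fin r, i < j → (|c₂| + 1)⁻¹ - 2 * κ ≤ θ.2 (π i) - θ.2 (π j) := by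
    intro i j hij
    have h1 := hgapL i i.2
    have h2 := hLanti (i := i + 1) (j := j) hij (j.2.trans_le hrm)
    have h3 := hupp i
    have h4 := hlow j
    linarith
  refine ⟨fun k => ?_, fun k => ?_, fun k l hkl => ?_⟩
  · have h1 := hlow (π.symm k)
    rw [Equiv.apply_symm_apply] at h1
    have h2 := hLanti (Nat.zero_le (π.symm k : ℕ)) ((π.symm k).2.trans_le hrm)
    have h3 : L 0 ≤ c₁ := h.le_bound
    linarith
  · have h1 := hupp (π.symm k)
    rw [Equiv.apply_symm_apply] at h1
    have h2 := hgapL _ (π.symm k).2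
    -- The next index may equal `m` (when `r = m`); the default value `0` then makes the last gap a
    -- lower bound on the last eigenvalue itself.
    have h3 := hL0 ((π.symm k : ℕ) + 1)
    linarith
  · rcases lt_or_gt_of_ne (fun h' => hkl (π.symm.injective h')) with h' | h'
    · have := hlt _ _ h'
      simp only [Equiv.apply_symm_apply] at this
      exact this.trans (le_abs_self _)
    · have := hlt _ _ h'
      simp only [Equiv.apply_symm_apply] at this
      rw [abs_sub_comm]
      exact this.trans (le_abs_self _)

end Parameters

/-! ### Model error, union bound and choice of constants. -/

section Main

/-- A bound for the projected covariance matrix gives one for the model covariance matrix. -/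
lemma abs_form_sub_modelCov_le {m M r : ℕ} {s σ : ℝ} (hs : 0 ≤ s)
    {Φ : Matrix (Fin M) (Fin m) ℝ} (hΦ : Φ * Φᵀ = 1) {S₀ : Matrix (Fin m) (Fin m) ℝ}
    {θ : Matrix (Fin M) (Fin r) ℝ × (Fin r → ℝ)} (hθ : θ ∈ paramSpace M r) {κ : ℝ} (hκ : 0 ≤ κ)
    (hS₀ : ‖S₀ - s • (Φᵀ * θ.1 * Matrix.diagonal θ.2 * θ.1ᵀ * Φ)‖ ≤ κ * σ ^ 2) (x : Fin M → ℝ) :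
    |x ⬝ᵥ (Φ * (S₀ + σ ^ 2 • 1) * Φᵀ) *ᵥ x - x ⬝ᵥ modelCov s σ θ *ᵥ x| ≤
      κ * (x ⬝ᵥ modelCov s σ θ *ᵥ x) := by
  have hxx : (Φᵀ *ᵥ x) ⬝ᵥ (Φᵀ *ᵥ x) = x ⬝ᵥ x :=
    dotProduct_mulVec_self_of_orthonormal (by rw [Matrix.transpose_transpose, hΦ]) x x
  have e : Φ * (S₀ + σ ^ 2 • 1) * Φᵀ - modelCov s σ θ =
      Φ * (S₀ - s • (Φᵀ * θ.1 * Matrix.diagonal θ.2 * θ.1ᵀ * Φ)) * Φᵀ := by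
    have h1 : Φ * (s • (Φᵀ * θ.1 * Matrix.diagonal θ.2 * θ.1ᵀ * Φ)) * Φᵀ =
        s • (θ.1 * Matrix.diagonal θ.2 * θ.1ᵀ) := by
      rw [Matrix.mul_smul, Matrix.smul_mul]
      congr 1
      calc _ = (Φ * Φᵀ) * (θ.1 * Matrix.diagonal θ.2 * θ.1ᵀ) * (Φ * Φᵀ) := by
            simp only [Matrix.mul_assoc]
        _ = _ := by rw [hΦ, Matrix.one_mul, Matrix.mul_one]
    rw [Matrix.mul_sub, Matrix.sub_mul, h1, Matrix.mul_add, Matrix.add_mul, Matrix.mul_smul,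
      Matrix.mul_one, Matrix.smul_mul, hΦ, modelCov]
    abel
  rw [← dotProduct_sub, ← Matrix.sub_mulVec, e, Matrix.mul_assoc, ← Matrix.mulVec_mulVec,
    dotProduct_mulVec_transpose, ← Matrix.mulVec_mulVec]
  refine (abs_dotProduct_mulVec_le_frobenius _ _).trans ?_
  rw [hxx]
  refine (mul_le_mul_of_nonneg_right hS₀ (dotProduct_self_nonneg' x)).trans ?_
  rw [mul_assoc]
  refine mul_le_mul_of_nonneg_left ?_ hκ
  -- The absolute error `κ σ² |x|²` becomes relative because `Γ ≥ σ² I`.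
  rw [dotProduct_modelCov_mulVec]
  have : 0 ≤ ∑ k, θ.2 k * ((θ.1ᵀ *ᵥ x) k * (θ.1ᵀ *ᵥ x) k) :=
    Finset.sum_nonneg fun k _ => mul_nonneg (hθ.2 k).le (mul_self_nonneg _)
  have := mul_nonneg hs this
  linarith

/-- For `n ≥ 9`, `8M + 1 ≤ n²`, so the `2` in `2 + η` pays for the lattice points and `η` is left
for the probability. -/
lemma card_lattice_mul_exp_le {n M : ℕ} (hn : 9 ≤ n) (hM : 1 ≤ M) (hMn : M ≤ n) {η : ℝ}
    (hη : 0 < η) :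
    (8 * M + 1 : ℝ) ^ M * (2 * Real.exp (-((2 + η) * (M * Real.log n)))) ≤
      2 * (n : ℝ) ^ (-η) := by
  have hn0 : (0 : ℝ) < n := by exact_mod_cast (by omega : 0 < n)
  have hn9 : (9 : ℝ) ≤ n := by exact_mod_cast hn
  have hMn' : (M : ℝ) ≤ n := by exact_mod_cast hMn
  have hM1 : (1 : ℝ) ≤ M := by exact_mod_cast hM
  have hlog : 0 ≤ Real.log n := Real.log_nonneg (by linarith)
  have h1 : (8 * M + 1 : ℝ) ^ M ≤ Real.exp (2 * (M * Real.log n)) := by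
    calc (8 * M + 1 : ℝ) ^ M ≤ ((n : ℝ) ^ 2) ^ M :=
          pow_le_pow_left₀ (by positivity) (by nlinarith) M
      _ = Real.exp (2 * (M * Real.log n)) := by
          rw [← pow_mul, ← Real.exp_log (pow_pos hn0 (2 * M)), Real.log_pow]
          push_cast
          ring_nf
  calc _ ≤ Real.exp (2 * (M * Real.log n)) * (2 * Real.exp (-((2 + η) * (M * Real.log n)))) :=
        mul_le_mul_of_nonneg_right h1 (by positivity)
    _ = 2 * Real.exp (-(η * (M * Real.log n))) := by
        rw [mul_left_comm, ← Real.exp_add]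
        congr 2
        ring
    _ ≤ 2 * (n : ℝ) ^ (-η) := by
        rw [Real.rpow_def_of_pos hn0]
        refine mul_le_mul_of_nonneg_left (Real.exp_le_exp.2 ?_) zero_le_two
        have := mul_le_mul_of_nonneg_left (mul_le_mul_of_nonneg_right hM1 hlog) hη.le
        linarith

end Main

end RemlMatrix

theorem theorem3 (r : ℕ) (hr : 1 ≤ r) (c₁ c₂ K η : ℝ) (hη : 0 < η) :
    ∃ c₀ > 0, ∃ C > 0,
      ∀ (m M : ℕ → ℕ) (s σ : ℕ → ℝ)
        (Φ : ∀ n, Matrix (Fin (M n)) (Fin (m n)) ℝ)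
        (S₀ : ∀ n, Matrix (Fin (m n)) (Fin (m n)) ℝ)
        (θ : ∀ n, Matrix (Fin (M n)) (Fin r) ℝ × (Fin r → ℝ))
        (Ω : ℕ → Type*) [∀ n, MeasurableSpace (Ω n)]
        (P : ∀ n, Measure (Ω n)) [∀ n, IsProbabilityMeasure (P n)]
        (Y : ∀ n, Fin n → Ω n → EuclideanSpace ℝ (Fin (m n))),
        (∀ n, r ≤ M n) → (∀ n, M n ≤ m n) →
        Tendsto (fun n : ℕ => (M n : ℝ) * Real.log n / n) atTop (𝓝 0) →
        (∀ n, 0 < σ n) → (∀ n, σ n ^ 2 ≤ s n) →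
        (∀ n, Φ n * (Φ n)ᵀ = 1) →
        (∀ n, RemlMatrix.EigenvalueCondition (S₀ n) (s n) r c₁ c₂) →
        (∀ n, θ n ∈ RemlMatrix.paramSpace (M n) r) →
        (∀ᶠ n : ℕ in atTop,
          ‖S₀ n - s n • ((Φ n)ᵀ * (θ n).1 * Matrix.diagonal (θ n).2 * (θ n).1ᵀ * Φ n)‖ ≤
            K * (σ n ^ 2 * √((M n : ℝ) * Real.log n / n))) →
        (∀ n i, HasLaw (Y n i) (multivariateGaussian 0 (S₀ n + σ n ^ 2 • 1)) (P n)) →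
        (∀ n, iIndepFun (Y n) (P n)) →
        -- the exceptional set, of outer measure at most `C * n ^ (-η)`
        ∀ᶠ n : ℕ in atTop,
          (P n).real {ω | ¬ ∃ p : Matrix (Fin (M n)) (Fin r) ℝ × (Fin r → ℝ),
            RemlMatrix.IsReml (Φ n) (s n) (σ n) (fun i => Y n i ω) p ∧
            RemlMatrix.ErrorBounds (s n) (σ n)
              (c₀ * σ n * √((M n : ℝ) * Real.log n / (n * s n))) p (θ n)} ≤
            C * (n : ℝ) ^ (-η) := by
  -- Half the gap of the true covariance: the model error consumes at most the other half for large
  -- `n`.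
  set g : ℝ := (|c₂| + 1)⁻¹ / 2 with hg
  have hg0 : 0 < g := by positivity
  set c : ℝ := |c₁| + 1 with hc
  have hc0 : 0 < c := by positivity
  set K₁ : ℝ := max K 0 with hK₁
  have hK₁0 : 0 ≤ K₁ := le_max_right _ _
  -- Chosen so that the exponent `n (a ε)² / 16` equals `(2 + η) M log n`.
  set a : ℝ := 4 * √(2 + η) with ha
  have ha0 : 0 < a := by
    have : 0 < 2 + η := by linarith
    positivity
  have ha2 : a ^ 2 / 16 = 2 + η := by
    rw [ha, mul_pow, Real.sq_sqrt (by linarith)]; ring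
  -- The sampling error is `4 a ε` relative to the true projected covariance, which is at most `2
  -- Γ`; the model error adds `K₁ ε`.
  set C₁ : ℝ := 8 * a + K₁ with hC₁
  have hC₁0 : 0 < C₁ := by positivity
  set CD : ℝ := r * (2 * (c + 1) / g + r * (2 * (c + 1) / g) ^ 2 + (c + 1)) with hCD
  have hr0 : (0 : ℝ) < r := by exact_mod_cast hr
  have hCD0 : 0 < CD := by positivity
  refine ⟨CD * C₁, by positivity, 2, two_pos, ?_⟩
  intro m M s σ Φ S₀ θ Ω _ P _ Y hrM hMm hlim hσ hσs hΦ heig hθ hmodel hlaw hind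
  set ε : ℕ → ℝ := fun n => √((M n : ℝ) * Real.log n / n) with hε
  have hεlim : Tendsto ε atTop (𝓝 0) := by
    have := (Real.continuous_sqrt.tendsto 0).comp hlim
    rwa [Real.sqrt_zero] at this
  have hsmall : ∀ b b' : ℝ, 0 < b' → ∀ᶠ n in atTop, b * ε n < b' := by
    intro b b' hb'
    have := hεlim.const_mul b
    rw [mul_zero] at this
    exact this.eventually_lt_const hb'
  filter_upwards [hmodel, eventually_ge_atTop 9, hlim.eventually_lt_const one_pos,
    hsmall a 1 one_pos, hsmall K₁ 1 one_pos, hsmall K₁ (g / 2) (by positivity),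
    hsmall (C₁ * (c + 1)) (g / 2) (by positivity), hsmall C₁ 1 one_pos]
    with n hmod hn9 hMlog haε hKε hKεg hCεg hCε
  have hn0 : (0 : ℝ) < n := by exact_mod_cast (by omega : 0 < n)
  have hM1 : 1 ≤ M n := hr.trans (hrM n)
  have hlog1 : 1 ≤ Real.log n := by
    rw [Real.le_log_iff_exp_le hn0]
    have : (9 : ℝ) ≤ n := by exact_mod_cast hn9
    linarith [Real.exp_one_lt_d9]
  have hMn : M n ≤ n := by
    rw [div_lt_one hn0] at hMlog
    have : (M n : ℝ) ≤ n := by nlinarith [Nat.cast_nonneg (α := ℝ) (M n)]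
    exact_mod_cast this
  have hε0 : 0 ≤ ε n := Real.sqrt_nonneg _
  have hσ2 : 0 < σ n ^ 2 := pow_pos (hσ n) 2
  have hs : 0 < s n := hσ2.trans_le (hσs n)
  have hmod' : ‖S₀ n - s n • ((Φ n)ᵀ * (θ n).1 * Matrix.diagonal (θ n).2 * (θ n).1ᵀ * Φ n)‖ ≤
      (K₁ * ε n) * σ n ^ 2 := by
    refine hmod.trans ?_
    have : K * (σ n ^ 2 * ε n) ≤ K₁ * (σ n ^ 2 * ε n) :=
      mul_le_mul_of_nonneg_right (le_max_left _ _) (by positivity)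
    linarith
  have hmods : ‖S₀ n - s n • ((Φ n)ᵀ * (θ n).1 * Matrix.diagonal (θ n).2 * (θ n).1ᵀ * Φ n)‖ ≤
      s n * (K₁ * ε n) := by
    refine hmod'.trans ?_
    rw [mul_comm]
    exact mul_le_mul_of_nonneg_right (hσs n) (by positivity)
  obtain ⟨hΛc, hΛg, hgap⟩ :=
    (heig n).param_bounds hs ((hrM n).trans (hMm n)) (hΦ n) (hθ n) hmods
  have h2g : (|c₂| + 1)⁻¹ = 2 * g := by rw [hg]; ring
  rw [h2g] at hΛg hgap
  have hclose := RemlMatrix.abs_form_sub_modelCov_le hs.le (hΦ n) (hθ n)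
    (mul_nonneg hK₁0 hε0) hmod'
  have hΓ : ∀ x, σ n ^ 2 * (x ⬝ᵥ x) ≤ x ⬝ᵥ RemlMatrix.modelCov (s n) (σ n) (θ n) *ᵥ x := by
    intro x
    rw [RemlMatrix.dotProduct_modelCov_mulVec]
    have := mul_nonneg hs.le (Finset.sum_nonneg fun k (_ : k ∈ Finset.univ) =>
      mul_nonneg ((hθ n).2 k).le (mul_self_nonneg (((θ n).1ᵀ *ᵥ x) k)))
    linarith
  have hpsd : (S₀ n + σ n ^ 2 • (1 : Matrix (Fin (m n)) (Fin (m n)) ℝ)).PosSemidef :=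
    (heig n).posSemidef.add (Matrix.PosSemidef.one.smul hσ2.le)
  have hpos : ∀ x, x ≠ 0 →
      0 < x ⬝ᵥ (Φ n * (S₀ n + σ n ^ 2 • 1) * (Φ n)ᵀ) *ᵥ x := by
    intro x hx
    have h1 := (abs_le.1 (hclose x)).1
    have h2 := hΓ x
    have h3 : 0 < x ⬝ᵥ x := (RemlMatrix.dotProduct_self_nonneg' x).lt_of_ne
      fun h => hx (dotProduct_self_eq_zero.1 h.symm)
    have h4 := mul_pos hσ2 h3
    nlinarith
  have hprob := RemlMatrix.measureReal_sampleCov_deviation_le (P := P n) (by omega : 0 < n) hM1 hpsd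
    hpos (hlaw n) (hind n) (mul_nonneg ha0.le hε0) haε.le
  have hexp : (n : ℝ) * (a * ε n) ^ 2 / 16 = (2 + η) * (M n * Real.log n) := by
    have : ε n ^ 2 = M n * Real.log n / n := Real.sq_sqrt (by positivity)
    rw [mul_pow, this, ← ha2]
    field_simp
  rw [hexp] at hprob
  -- Monotonicity holds for outer measure, so measurability of the exceptional set is not needed.
  refine (measureReal_mono ?_ (measure_ne_top _ _)).trans
    (hprob.trans (RemlMatrix.card_lattice_mul_exp_le hn9 hM1 hMn hη))
  intro ω hω hgood
  refine hω ?_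
  have hα : CD * C₁ * σ n * √((M n : ℝ) * Real.log n / (n * s n)) =
      CD * (C₁ * ε n) * (σ n / √(s n)) := by
    rw [← div_div, Real.sqrt_div (by positivity)]
    simp only [ε]
    ring
  rw [hα]
  refine RemlMatrix.exists_isReml_errorBounds (hrM n) (hσ n) (hσs n) (hθ n) hg0 hc0.le
    (fun k => by have := hΛg k; linarith)
    (fun k => by have := hΛc k; have := le_abs_self c₁; linarith)
    (fun k l hkl => by have := hgap k l hkl; linarith)
    (by positivity) hCε (by linarith) ?_
  intro x
  have h1 := hgood x
  have h2 := hclose x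
  rw [Matrix.sub_mulVec, dotProduct_sub] at h1 ⊢
  set G := x ⬝ᵥ RemlMatrix.modelCov (s n) (σ n) (θ n) *ᵥ x with hG
  have hG0 : 0 ≤ G :=
    (mul_nonneg hσ2.le (RemlMatrix.dotProduct_self_nonneg' x)).trans (hΓ x)
  have h3 : x ⬝ᵥ (Φ n * (S₀ n + σ n ^ 2 • 1) * (Φ n)ᵀ) *ᵥ x ≤ 2 * G := by
    have h4 := (abs_le.1 h2).2
    have h5 := mul_le_mul_of_nonneg_right hKε.le hG0
    linarith
  have h6 := mul_le_mul_of_nonneg_left h3 (show 0 ≤ 4 * (a * ε n) by positivity)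
  refine (abs_sub_le _ (x ⬝ᵥ (Φ n * (S₀ n + σ n ^ 2 • 1) * (Φ n)ᵀ) *ᵥ x) _).trans ?_
  have h7 : C₁ * ε n * G = 4 * (a * ε n) * (2 * G) + K₁ * ε n * G := by rw [hC₁]; ring
  linarith
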